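/- **Setting.** Let $A$ be a unital C$^*$-algebra, $G$ a discrete group with identity $e$, and $(\alpha,\sigma)$ a twisted action of $G$ on $A$: maps $\alpha:G\to\mathrm{Aut}(A)$ (the $^*$-automorphisms) and $\sigma:G\times G\to\mathcal U(A)$ (the unitaries) such that for all $g,h,k\in G$ $$\alpha_g\circ\alpha_h=\mathrm{Ad}(\sigma(g,h))\circ\alpha_{gh},\qquad \sigma(g,h)\sigma(gh,k)=\alpha_g(\sigma(h,k))\sigma(g,hk),\qquad \sigma(g,e)=\sigma(e,g)=1 .$$ Write $\Sigma=(A,G,\alpha,\sigma)$. Let $A$ act faithfully on a Hilbert space $H$. The reduced crossed product $C_r^*(\Sigma)$ is the C$^*$-algebra of operators on $\ell^2(G,H)$ generated by the operators $$(\pi(a)\xi)(h)=\alpha_{h^{-1}}(a)\,\xi(h),\qquad (\lambda(g)\xi)(h)=\sigma(h^{-1},g)\,\xi(g^{-1}h)\qquad(a\in A,\ g,h\in G);$$ it contains a copy $\pi(A)$ of $A$ and, up to canonical isomorphism, does not depend on the choice of $H$. Let $E:C_r^*(\Sigma)\to A$ be its canonical conditional expectation: the bounded linear map with $E(\pi(a)\lambda(e))=a$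 and $E(\pi(a)\lambda(g))=0$ for $a\in A$, $g\ne e$. Ideals of C$^*$-algebras are closed and two-sided. An ideal $J$ of $A$ is *invariant* if $\alpha_g(J)=J$ for all $g\in G$; then $(\alpha,\sigma)$ induces a twisted action of $G$ on $A/J$, the resulting system is denoted by $\Sigma/J$, and there is a canonical $^*$-homomorphism $q_J:C_r^*(\Sigma)\to C_r^*(\Sigma/J)$ extending the quotient map $A\to A/J$ and sending each $\lambda(g)$ to the corresponding unitary of $C_r^*(\Sigma/J)$. Let $\langle J\rangle$ denote the ideal of $C_r^*(\Sigma)$ generated by (the copy of) $J$. The system $\Sigma$ is *exact* if $\langle J\rangle=\ker q_J$ for every invariant ideal $J$ of $A$. A *maximal invariant ideal* of $A$ is a maximal element among the proper invariant ideals of $A$; a *maximal ideal* of $C_r^*(\Sigma)$ is a maximal element among its proper ideals. A C$^*$-algebra is *simple* if it is nonzero and its only ideals are $\{0\}$ and itself. A tracial state $\varphi$ of $A$ is *invariant* if $\varphi\circ\alpha_g=\varphi$ for all $g\in G$. **The class $\mathcal P$.** For $M\subset G$, a set $T\subset G$ is *$M$-large* if $m(G\setminus T)\subset T$ for all $m\in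 M$. For nonempty $F\subset G\setminus\{e\}$, a set $H\subset G$ is a *Powers set for $F$* if for every $N\in\mathbb N$ there are $h_1,\dots,h_N\in H$ and pairwise disjoint subsets $T_1,\dots,T_N$ of $G$ such that $T_j$ is $h_jFh_j^{-1}$-large for every $j$. For $g\in G\setminus\{e\}$, $H$ is a *c-Powers set for $g$* if it is a Powers set for $\{aga^{-1}\mid a\in M\}$ for every finite nonempty $M\subset H$. The group $G$ is a *PH group* if every finite nonempty $F\subset G\setminus\{e\}$ can be listed as $F=\{f_1,\dots,f_n\}$ so that there is a chain of subgroups $G_1\subset G_2\subset\dots\subset G_n$ of $G$ with $G_j$ a c-Powers set for $f_j$, $j=1,\dots,n$. The group $G$ has *property $(P_{\rm com})$* if for every finite nonempty $F\subset G\setminus\{e\}$ there are $n\in\mathbb N$, $g_0\in G$ and subsets $U,D_1,\dots,D_n$ of $G$ such that $G\setminus U\subset D_1\cup\dots\cup D_n$, $gU\cap U=\emptyset$ for all $g\in F$, and $g_0^{-j}D_k\cap D_k=\emptyset$ for all $j\ge1$ and $1\le k\le n$. The class $\mathcal P$ consists of the PH groups and the groups with property $(P_{\rm com})$. **Statement.**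 Let $G\in\mathcal P$. 1. The map $\varphi\mapsto\varphi\circ E$ is a bijection from the set of invariant tracial states of $A$ onto the set of tracial states of $C_r^*(\Sigma)$. 2. Assume moreover that $\Sigma$ is exact. Then $J\mapsto\langle J\rangle$ is a bijection from the set of maximal invariant ideals of $A$ onto the set of maximal ideals of $C_r^*(\Sigma)$. Consequently, the simple quotients of $C_r^*(\Sigma)$ are exactly the algebras $C_r^*(\Sigma/J)$ with $J$ a maximal invariant ideal of $A$: for each such $J$, the map $q_J$ is surjective and $C_r^*(\Sigma/J)$ is simple; and for every surjective $^*$-homomorphism $q:C_r^*(\Sigma)\to D$ onto a simple unital C$^*$-algebra $D$ there are a maximal invariant ideal $J$ of $A$ and a $^*$-isomorphism $\theta:C_r^*(\Sigma/J)\to D$ with $\theta\circ q_J=q$. -/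

import Mathlib

open scoped ComplexOrder

noncomputable section

/-- Closed two-sided ideals of a unital C⋆-algebra. -/
structure ClosedIdeal (A : Type*) [CStarAlgebra A] where
  /-- the underlying algebraic two-sided ideal -/
  ideal : TwoSidedIdeal A
  isClosed : IsClosed (ideal : Set A)

namespace ClosedIdeal

variable {A : Type*} [CStarAlgebra A]

theorem ideal_injective : Function.Injective (ideal : ClosedIdeal A → TwoSidedIdeal A) := by
  rintro ⟨I, hI⟩ ⟨J, hJ⟩ h
  cases h
  rfl

instance : SetLike (ClosedIdeal A) A where
  coe J := (J.ideal : Set A)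
  coe_injective := fun _ _ h => ideal_injective (SetLike.coe_injective h)

instance : PartialOrder (ClosedIdeal A) := PartialOrder.lift ideal ideal_injective

/-- `J ≠ A`. -/
def IsProper (J : ClosedIdeal A) : Prop := ∃ a : A, a ∉ J

theorem exists_approx (J : ClosedIdeal A) {j : A} (hj : j ∈ J) {ε : ℝ} (hε : 0 < ε) :
    ∃ u ∈ J, star u = u ∧ ‖1 - u‖ ≤ 1 ∧ ‖j * (1 - u)‖ ≤ ε := by
  set b := star j * j with hb
  have hbsa : IsSelfAdjoint b := IsSelfAdjoint.star_mul_self j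
  have hspec : ∀ x ∈ spectrum ℝ b, 0 ≤ x := spectrum_star_mul_self_nonneg
  set t : ℝ := (ε ^ 2)⁻¹ with ht
  have ht0 : 0 < t := by positivity
  have hpos : ∀ x ∈ spectrum ℝ b, 0 < 1 + t * x := fun x hx => by
    have := mul_nonneg ht0.le (hspec x hx); linarith
  have hc1 : ContinuousOn (fun x : ℝ => t / (1 + t * x)) (spectrum ℝ b) :=
    ContinuousOn.div (by fun_prop) (by fun_prop) fun x hx => (hpos x hx).ne'
  have hc2 : ContinuousOn (fun x : ℝ => 1 / (1 + t * x)) (spectrum ℝ b) :=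
    ContinuousOn.div (by fun_prop) (by fun_prop) fun x hx => (hpos x hx).ne'
  set w := cfc (fun x : ℝ => 1 / (1 + t * x)) b with hw
  have hwsa : star w = w := (cfc_predicate (R := ℝ) (p := IsSelfAdjoint) _ b).star_eq
  have hu : b * cfc (fun x : ℝ => t / (1 + t * x)) b = 1 - w := by
    have h1 : b * cfc (fun x : ℝ => t / (1 + t * x)) b
        = cfc (fun x : ℝ => x * (t / (1 + t * x))) b := by
      rw [cfc_mul (fun x : ℝ => x) _ b (by fun_prop) hc1, cfc_id' ℝ b]
    have h2 : 1 - w = cfc (fun x : ℝ => 1 - 1 / (1 + t * x)) b := by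
      rw [cfc_sub (fun _ : ℝ => (1 : ℝ)) _ b (by fun_prop) hc2, cfc_const_one ℝ b]
    rw [h1, h2]
    refine cfc_congr fun x hx => ?_
    have := (hpos x hx).ne'
    change x * (t / (1 + t * x)) = 1 - 1 / (1 + t * x)
    rw [eq_sub_iff_add_eq, mul_div_assoc', ← add_div, div_eq_one_iff_eq this]
    ring
  refine ⟨1 - w, ?_, by simp [hwsa], ?_, ?_⟩
  · rw [← hu]
    exact J.ideal.mul_mem_right _ _ (J.ideal.mul_mem_left _ _ hj)
  · rw [sub_sub_cancel]
    refine norm_cfc_le zero_le_one fun x hx => ?_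
    have h1 := hpos x hx
    have h2 := mul_nonneg ht0.le (hspec x hx)
    rw [Real.norm_of_nonneg (by positivity), div_le_one h1]
    linarith
  · rw [sub_sub_cancel]
    have h : ‖j * w‖ * ‖j * w‖ ≤ ε ^ 2 := by
      rw [← CStarRing.norm_star_mul_self]
      have : star (j * w) * (j * w)
          = cfc (fun x : ℝ => 1 / (1 + t * x) * (x * (1 / (1 + t * x)))) b := by
        rw [cfc_mul _ _ b hc2 (by fun_prop), cfc_mul _ _ b (by fun_prop) hc2, cfc_id' ℝ b, star_mul,
          hwsa, hb]
        simp only [mul_assoc]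
        rfl
      rw [this]
      refine norm_cfc_le (by positivity) fun x hx => ?_
      have h1 := hpos x hx
      have h2 := mul_nonneg ht0.le (hspec x hx)
      have h3 := hspec x hx
      rw [Real.norm_of_nonneg (by positivity)]
      have h4 : ε ^ 2 * t = 1 := by rw [ht]; field_simp
      rw [show 1 / (1 + t * x) * (x * (1 / (1 + t * x))) = x / (1 + t * x) ^ 2 by field_simp,
        div_le_iff₀ (by positivity)]
      nlinarith [mul_nonneg (sq_nonneg ε) (sq_nonneg (t * x)), sq_nonneg ε]
    nlinarith [norm_nonneg (j * w)]

theorem star_mem (J : ClosedIdeal A) {j : A} (hj : j ∈ J) : star j ∈ J := by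
  have : star j ∈ closure (J.ideal : Set A) := by
    rw [Metric.mem_closure_iff]
    intro ε hε
    obtain ⟨u, hu, hsu, -, h⟩ := J.exists_approx hj (half_pos hε)
    refine ⟨u * star j, J.ideal.mul_mem_right _ _ hu, ?_⟩
    have : star j - u * star j = star (j * (1 - u)) := by simp [mul_sub, hsu]
    rw [dist_eq_norm, this, norm_star]
    linarith
  rwa [J.isClosed.closure_eq] at this

/-- The quotient C⋆-algebra `A / J`. -/
def Quotient (J : ClosedIdeal A) : Type _ := A ⧸ J.ideal.asIdeal

instance (J : ClosedIdeal A) : Ring J.Quotient := inferInstanceAs (Ring (A ⧸ J.ideal.asIdeal))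
instance (J : ClosedIdeal A) : Algebra ℂ J.Quotient :=
  inferInstanceAs (Algebra ℂ (A ⧸ J.ideal.asIdeal))

/-- The quotient map `A → A / J` as an algebra homomorphism. -/
def mkAlg (J : ClosedIdeal A) : A →ₐ[ℂ] J.Quotient := Ideal.Quotient.mkₐ ℂ J.ideal.asIdeal

theorem mkAlg_surjective (J : ClosedIdeal A) : Function.Surjective J.mkAlg :=
  Ideal.Quotient.mkₐ_surjective ℂ _

theorem mkAlg_eq_zero_iff (J : ClosedIdeal A) {a : A} : J.mkAlg a = 0 ↔ a ∈ J :=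
  Ideal.Quotient.eq_zero_iff_mem

theorem mkAlg_eq_iff (J : ClosedIdeal A) {a b : A} : J.mkAlg a = J.mkAlg b ↔ a - b ∈ J := by
  rw [← sub_eq_zero, ← map_sub, mkAlg_eq_zero_iff]

instance (J : ClosedIdeal A) : NormedAddCommGroup J.Quotient :=
  haveI : IsClosed (J.ideal.asIdeal : Set A) := J.isClosed
  inferInstanceAs (NormedAddCommGroup (A ⧸ J.ideal.asIdeal))

theorem norm_mkAlg_le (J : ClosedIdeal A) (a : A) : ‖J.mkAlg a‖ ≤ ‖a‖ :=
  Submodule.Quotient.norm_mk_le J.ideal.asIdeal a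

theorem exists_lift (J : ClosedIdeal A) (x : J.Quotient) {ε : ℝ} (hε : 0 < ε) :
    ∃ a, J.mkAlg a = x ∧ ‖a‖ < ‖x‖ + ε :=
  Submodule.Quotient.norm_mk_lt (S := J.ideal.asIdeal) x hε

instance (J : ClosedIdeal A) : Star J.Quotient where
  star := Quotient.lift (fun a => J.mkAlg (star a)) (fun a b h => by
    have : a - b ∈ J := by
      rw [← J.mkAlg_eq_iff]
      exact Quotient.sound h
    rw [J.mkAlg_eq_iff, ← star_sub]
    exact J.star_mem this)

theorem mkAlg_star (J : ClosedIdeal A) (a : A) : J.mkAlg (star a) = star (J.mkAlg a) := rfl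

instance (J : ClosedIdeal A) : NormedRing J.Quotient where
  dist_eq := NormedAddCommGroup.dist_eq
  norm_mul_le x y := by
    refine le_of_forall_pos_le_add fun ε hε => ?_
    have key : Filter.Tendsto (fun δ : ℝ => (‖x‖ + δ) * (‖y‖ + δ)) (nhdsWithin 0 (Set.Ioi 0))
        (nhds (‖x‖ * ‖y‖)) := by
      have : Continuous fun δ : ℝ => (‖x‖ + δ) * (‖y‖ + δ) := by fun_prop
      simpa using (this.tendsto 0).mono_left nhdsWithin_le_nhds
    obtain ⟨δ, hδ, hδ0⟩ := ((key.eventually (gt_mem_nhds (lt_add_of_pos_right (‖x‖ * ‖y‖) hε))).and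
      self_mem_nhdsWithin).exists
    obtain ⟨a, rfl, ha⟩ := J.exists_lift x hδ0
    obtain ⟨b, rfl, hb⟩ := J.exists_lift y hδ0
    rw [← map_mul]
    calc _ ≤ ‖a * b‖ := J.norm_mkAlg_le _
      _ ≤ ‖a‖ * ‖b‖ := norm_mul_le _ _
      _ ≤ (‖J.mkAlg a‖ + δ) * (‖J.mkAlg b‖ + δ) := by gcongr
      _ ≤ _ := hδ.le

instance (J : ClosedIdeal A) : StarRing J.Quotient where
  star_involutive x := by
    obtain ⟨a, rfl⟩ := J.mkAlg_surjective x
    simp [← mkAlg_star]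
  star_mul x y := by
    obtain ⟨a, rfl⟩ := J.mkAlg_surjective x
    obtain ⟨b, rfl⟩ := J.mkAlg_surjective y
    simp [← mkAlg_star, ← map_mul]
  star_add x y := by
    obtain ⟨a, rfl⟩ := J.mkAlg_surjective x
    obtain ⟨b, rfl⟩ := J.mkAlg_surjective y
    simp [← mkAlg_star, ← map_add]

instance (J : ClosedIdeal A) : CStarAlgebra J.Quotient where
  complete := (inferInstance : CompleteSpace (A ⧸ J.ideal.asIdeal)).complete
  norm_smul_le c x := by
    refine le_of_forall_pos_le_add fun ε hε => ?_
    have hc : 0 < ‖c‖ + 1 := by positivity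
    obtain ⟨a, rfl, ha⟩ := J.exists_lift x (div_pos hε hc)
    rw [← map_smul]
    calc _ ≤ ‖c • a‖ := J.norm_mkAlg_le _
      _ = ‖c‖ * ‖a‖ := norm_smul _ _
      _ ≤ ‖c‖ * (‖J.mkAlg a‖ + ε / (‖c‖ + 1)) := by gcongr
      _ = ‖c‖ * ‖J.mkAlg a‖ + ε * (‖c‖ / (‖c‖ + 1)) := by ring
      _ ≤ ‖c‖ * ‖J.mkAlg a‖ + ε * 1 := by
          gcongr
          rw [div_le_one hc]; linarith
      _ = _ := by ring
  star_smul c x := by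
    obtain ⟨a, rfl⟩ := J.mkAlg_surjective x
    simp [← mkAlg_star, ← map_smul]
  norm_mul_self_le x := by
    obtain ⟨a, rfl⟩ := J.mkAlg_surjective x
    rw [← mkAlg_star, ← map_mul]
    refine le_of_forall_pos_le_add fun ε hε => ?_
    obtain ⟨c, hc, hcn⟩ := J.exists_lift (J.mkAlg (star a * a)) (half_pos hε)
    have hj := J.mkAlg_eq_iff.1 hc
    obtain ⟨u, hu, hsu, hu1, hju⟩ := J.exists_approx hj (half_pos hε)
    have h1 : J.mkAlg a = J.mkAlg (a * (1 - u)) := by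
      rw [J.mkAlg_eq_iff, mul_sub, mul_one, sub_sub_cancel]
      exact J.ideal.mul_mem_left _ _ hu
    have hs : star (1 - u) = 1 - u := by simp [hsu]
    have h2 : star (a * (1 - u)) * (a * (1 - u))
        = (1 - u) * c * (1 - u) - (1 - u) * ((c - star a * a) * (1 - u)) := by
      rw [star_mul, hs]; noncomm_ring
    calc ‖J.mkAlg a‖ * ‖J.mkAlg a‖ ≤ ‖a * (1 - u)‖ * ‖a * (1 - u)‖ := by
          rw [h1]; gcongr <;> exact J.norm_mkAlg_le _
      _ = ‖star (a * (1 - u)) * (a * (1 - u))‖ := CStarRing.norm_star_mul_self.symm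
      _ ≤ ‖(1 - u) * c * (1 - u)‖ + ‖(1 - u) * ((c - star a * a) * (1 - u))‖ := by
          rw [h2]; exact norm_sub_le _ _
      _ ≤ 1 * ‖c‖ * 1 + 1 * (ε / 2) := by
          gcongr
          · exact (norm_mul_le _ _).trans (mul_le_mul ((norm_mul_le _ _).trans
              (mul_le_mul_of_nonneg_right hu1 (norm_nonneg _))) hu1 (norm_nonneg _) (by positivity))
          · exact (norm_mul_le _ _).trans (mul_le_mul hu1 hju (norm_nonneg _) zero_le_one)
      _ ≤ _ := by linarith

/-- The quotient map `A → A / J`. -/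
def proj (J : ClosedIdeal A) : A →⋆ₐ[ℂ] J.Quotient where
  __ := J.mkAlg
  map_star' := J.mkAlg_star

end ClosedIdeal
section Operators

variable {I J : Type*} {E : I → Type*} {F : J → Type*}
  [∀ i, NormedAddCommGroup (E i)] [∀ i, InnerProductSpace ℂ (E i)]
  [∀ j, NormedAddCommGroup (F j)] [∀ j, InnerProductSpace ℂ (F j)]

/-- The operator `(ξ_i)_i ↦ (T_j ξ_{s(j)})_j` between Hilbert space direct sums, for an injective
reindexing map `s` and a uniformly bounded family `T`. -/
def lpMap (s : J → I) (hs : Function.Injective s) (T : ∀ j, E (s j) →L[ℂ] F j)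
    (C : ℝ) (hT : ∀ j, ‖T j‖ ≤ C) : lp E 2 →L[ℂ] lp F 2 :=
  have h2 : (0 : ℝ) < (2 : ENNReal).toReal := by norm_num
  have key : ∀ (ξ : lp E 2) (t : Finset J), ∑ j ∈ t, ‖T j (ξ (s j))‖ ^ (2 : ENNReal).toReal
      ≤ (max C 0 * ‖ξ‖) ^ (2 : ENNReal).toReal := fun ξ t => by
    classical
    rw [Real.mul_rpow (by positivity) (by positivity)]
    calc _ ≤ ∑ j ∈ t, (max C 0) ^ (2 : ENNReal).toReal * ‖ξ (s j)‖ ^ (2 : ENNReal).toReal := by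
          refine Finset.sum_le_sum fun j _ => ?_
          rw [← Real.mul_rpow (by positivity) (by positivity)]
          refine Real.rpow_le_rpow (by positivity) (((T j).le_opNorm _).trans ?_) h2.le
          gcongr
          exact (hT j).trans (le_max_left _ _)
      _ = (max C 0) ^ (2 : ENNReal).toReal *
          ∑ i ∈ t.map ⟨s, hs⟩, ‖ξ i‖ ^ (2 : ENNReal).toReal := by
          rw [← Finset.mul_sum, Finset.sum_map]; rfl
      _ ≤ _ := by
          gcongr
          exact lp.sum_rpow_le_norm_rpow h2 ξ _
  LinearMap.mkContinuous
    { toFun := fun ξ => ⟨fun j => T j (ξ (s j)), memℓp_gen' (key ξ)⟩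
      map_add' := fun ξ η => by ext j; exact map_add (T j) _ _
      map_smul' := fun c ξ => by ext j; exact map_smul (T j) _ _ }
    (max C 0) (fun ξ => lp.norm_le_of_forall_sum_le h2 (by positivity) (key ξ))

@[simp]
theorem lpMap_apply (s : J → I) (hs : Function.Injective s) (T : ∀ j, E (s j) →L[ℂ] F j)
    (C : ℝ) (hT : ∀ j, ‖T j‖ ≤ C) (ξ : lp E 2) (j : J) :
    lpMap s hs T C hT ξ j = T j (ξ (s j)) := rfl

variable [∀ i, CompleteSpace (E i)] [∀ j, CompleteSpace (F j)]

open ContinuousLinearMap in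
/-- If every `T_j` is a coisometry then so is the operator defined by the family. -/
theorem lpMap_comp_adjoint (s : J → I) (hs : Function.Injective s) (T : ∀ j, E (s j) →L[ℂ] F j)
    (C : ℝ) (hT : ∀ j, ‖T j‖ ≤ C) (h : ∀ j, T j ∘L adjoint (T j) = 1) :
    lpMap s hs T C hT ∘L adjoint (lpMap s hs T C hT) = 1 := by
  classical
  have h1 : ∀ j v, adjoint (lpMap s hs T C hT) (lp.single 2 j v)
      = lp.single 2 (s j) (adjoint (T j) v) := fun j v => by
    refine ext_inner_left ℂ fun ξ => ?_
    rw [adjoint_inner_right, lp.inner_single_right, lp.inner_single_right, adjoint_inner_right,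
      lpMap_apply]
  refine lp.ext_continuousLinearMap (by norm_num) fun j => ?_
  ext1 v
  change lpMap s hs T C hT (adjoint (lpMap s hs T C hT) (lp.single 2 j v)) = lp.single 2 j v
  rw [h1]
  ext k
  rw [lpMap_apply]
  by_cases hk : k = j
  · subst hk
    rw [lp.single_apply_self, lp.single_apply_self]
    exact DFunLike.congr_fun (h k) v
  · rw [lp.single_apply_ne _ _ _ hk, lp.single_apply_ne _ _ _ (hs.ne hk), map_zero]

/-- The direct sum of a family of representations of a C⋆-algebra on Hilbert spaces. -/
def directSumRep {A : Type*} [CStarAlgebra A] (ρ : ∀ i, A →⋆ₐ[ℂ] (E i →L[ℂ] E i)) :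
    A →⋆ₐ[ℂ] (lp E 2 →L[ℂ] lp E 2) where
  toFun a := lpMap id Function.injective_id (fun i => ρ i a) ‖a‖
    (fun i => NonUnitalStarAlgHom.norm_apply_le (ρ i) a)
  map_one' := by ext ξ i; simp
  map_mul' a b := by ext ξ i; simp
  map_zero' := by ext ξ i; simp
  map_add' a b := by ext ξ i; simp
  commutes' c := by ext ξ i; simp [Algebra.algebraMap_eq_smul_one]
  map_star' a := by
    rw [ContinuousLinearMap.star_eq_adjoint, ContinuousLinearMap.eq_adjoint_iff]
    intro ξ η
    rw [lp.inner_eq_tsum, lp.inner_eq_tsum]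
    refine tsum_congr fun i => ?_
    rw [lpMap_apply, lpMap_apply, map_star, ContinuousLinearMap.star_eq_adjoint]
    exact ContinuousLinearMap.adjoint_inner_left _ _ _

@[simp]
theorem directSumRep_apply {A : Type*} [CStarAlgebra A] (ρ : ∀ i, A →⋆ₐ[ℂ] (E i →L[ℂ] E i))
    (a : A) (ξ : lp E 2) (i : I) : directSumRep ρ a ξ i = ρ i a (ξ i) := rfl

end Operators

section UniversalRep

attribute [local instance] CStarAlgebra.spectralOrder CStarAlgebra.spectralOrderedRing

variable (A : Type*) [CStarAlgebra A]

/-- The Hilbert space of the universal representation of `A`: the direct sum of the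
Gelfand-Naimark-Segal spaces of all positive linear functionals. -/
def UniversalSpace : Type _ := lp (fun f : A →ₚ[ℂ] ℂ => f.GNS) 2

instance : NormedAddCommGroup (UniversalSpace A) :=
  (inferInstance : NormedAddCommGroup (lp (fun f : A →ₚ[ℂ] ℂ => f.GNS) 2))
instance : InnerProductSpace ℂ (UniversalSpace A) :=
  (inferInstance : InnerProductSpace ℂ (lp (fun f : A →ₚ[ℂ] ℂ => f.GNS) 2))
instance : CompleteSpace (UniversalSpace A) :=
  (inferInstance : CompleteSpace (lp (fun f : A →ₚ[ℂ] ℂ => f.GNS) 2))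

/-- The universal representation of `A`. -/
def universalRep : A →⋆ₐ[ℂ] (UniversalSpace A →L[ℂ] UniversalSpace A) :=
  directSumRep (fun f : A →ₚ[ℂ] ℂ => f.gnsStarAlgHom)

variable {A}

theorem exists_positive_ne_zero {a : A} (ha : a ≠ 0) : ∃ f : A →ₚ[ℂ] ℂ, f (star a * a) ≠ 0 := by
  have hmem : -(star a * a) ∉ ProperCone.positive ℝ A := fun h => by
    have h1 : 0 ≤ -(star a * a) := h
    have h2 : star a * a = 0 := le_antisymm (by simpa using h1) (star_mul_self_nonneg a)
    exact ha (CStarRing.star_mul_self_eq_zero_iff a |>.1 h2)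
  obtain ⟨g, hg, hga⟩ := ProperCone.hyperplane_separation_point _ hmem
  let r : Module.Dual ℝ A := g.toLinearMap ∘ₗ (selfAdjoint.submodule ℝ A).subtype ∘ₗ realPart
  have hr : ∀ x : A, IsSelfAdjoint x → r x = g x := fun x hx => by
    change g (realPart x : A) = g x
    rw [hx.coe_realPart]
  have hrI : ∀ x : A, IsSelfAdjoint x → r (Complex.I • x) = 0 := fun x hx => by
    change g (realPart (Complex.I • x) : A) = 0
    rw [realPart_I_smul, hx.imaginaryPart]
    simp
  have hfx : ∀ x : A, IsSelfAdjoint x → r.extendRCLike (𝕜 := ℂ) x = (g x : ℂ) := fun x hx => by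
    rw [Module.Dual.extendRCLike_apply, hr x hx]
    have := hrI x hx
    simp [this]
  refine ⟨PositiveLinearMap.mk₀ (r.extendRCLike (𝕜 := ℂ)) fun x hx => ?_, ?_⟩
  · rw [hfx x (.of_nonneg hx)]
    exact_mod_cast hg x hx
  · change r.extendRCLike (𝕜 := ℂ) (star a * a) ≠ 0
    rw [hfx _ (IsSelfAdjoint.star_mul_self a)]
    rw [map_neg] at hga
    exact_mod_cast (by linarith : 0 < g (star a * a)).ne'

theorem universalRep_injective : Function.Injective (universalRep A) := by
  classical
  rw [injective_iff_map_eq_zero]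
  intro a ha
  by_contra hne
  obtain ⟨f, hf⟩ := exists_positive_ne_zero hne
  have h1 : directSumRep (fun f : A →ₚ[ℂ] ℂ => f.gnsStarAlgHom) a
      (lp.single 2 f ((f.toPreGNS 1 : f.PreGNS) : f.GNS)) f = 0 := by
    have h0 : directSumRep (fun f : A →ₚ[ℂ] ℂ => f.gnsStarAlgHom) a = 0 := ha
    rw [h0]; rfl
  have h2 : ((f.toPreGNS a : f.PreGNS) : f.GNS) = 0 := by
    have h3 : f.gnsStarAlgHom a ((f.toPreGNS 1 : f.PreGNS) : f.GNS) = 0 := by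
      have := directSumRep_apply (fun f : A →ₚ[ℂ] ℂ => f.gnsStarAlgHom) a
        (lp.single 2 f ((f.toPreGNS 1 : f.PreGNS) : f.GNS)) f
      rw [lp.single_apply_self] at this
      exact this.symm.trans h1
    simpa using h3
  have h4 : ‖f.toPreGNS a‖ ^ 2 = 0 := by
    rw [← UniformSpace.Completion.norm_coe, h2]; simp
  apply hf
  have := f.preGNS_norm_sq (f.toPreGNS a)
  rw [PositiveLinearMap.ofPreGNS_toPreGNS] at this
  rw [← this]
  exact_mod_cast h4

end UniversalRep

/-- A twisted action of the discrete group `G` on the unital C⋆-algebra `A`; together with `A` and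
`G` this is a twisted unital discrete C⋆-dynamical system. -/
structure TwistedAction (A G : Type*) [CStarAlgebra A] [Group G] where
  /-- the automorphisms `α_g` -/
  act : G → (A ≃⋆ₐ[ℂ] A)
  /-- the unitaries `σ(g, h)` -/
  cocycle : G → G → unitary A
  act_act : ∀ g h a,
    act g (act h a) = cocycle g h * act (g * h) a * star (cocycle g h : A)
  cocycle_mul : ∀ g h k,
    (cocycle g h * cocycle (g * h) k : A) = act g (cocycle h k) * cocycle g (h * k)
  cocycle_one_right : ∀ g, cocycle g 1 = 1
  cocycle_one_left : ∀ g, cocycle 1 g = 1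

namespace TwistedAction

variable {A G : Type*} [CStarAlgebra A] [Group G] (S : TwistedAction A G)

@[simp]
theorem act_one (a : A) : S.act 1 a = a := by
  apply EquivLike.injective (S.act 1)
  rw [S.act_act, S.cocycle_one_left]
  simp

theorem act_act_mul_cocycle (g h : G) (a : A) :
    S.act g (S.act h a) * S.cocycle g h = S.cocycle g h * S.act (g * h) a := by
  rw [S.act_act, mul_assoc, Unitary.star_mul_self_of_mem (S.cocycle g h).2, mul_one]

theorem norm_cocycle_le (g h : G) : ‖universalRep A (S.cocycle g h)‖ ≤ 1 :=
  (NonUnitalStarAlgHom.norm_apply_le (universalRep A) _).trans <| by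
    rcases subsingleton_or_nontrivial A with hA | hA
    · rw [Subsingleton.elim (S.cocycle g h : A) 0, norm_zero]
      exact zero_le_one
    · exact (CStarRing.norm_coe_unitary _).le

/-- The Hilbert space `ℓ²(G, H)`, where `H` carries the (faithful) universal representation of
`A`. -/
abbrev Space (_S : TwistedAction A G) : Type _ := lp (fun _ : G => UniversalSpace A) 2

/-- The representation of `A` on `ℓ²(G, H)`: `(π(a)ξ)(h) = α_{h⁻¹}(a) ξ(h)`. -/
def regRep : A →⋆ₐ[ℂ] (S.Space →L[ℂ] S.Space) :=
  directSumRep fun h : G => (universalRep A).comp (S.act h⁻¹ : A →⋆ₐ[ℂ] A)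

/-- The operators `(λ(g)ξ)(h) = σ(h⁻¹, g) ξ(g⁻¹h)` on `ℓ²(G, H)`. -/
def regShift (g : G) : S.Space →L[ℂ] S.Space :=
  lpMap (fun h : G => g⁻¹ * h) (mul_right_injective g⁻¹)
    (fun h => universalRep A (S.cocycle h⁻¹ g)) 1 (fun h => S.norm_cocycle_le h⁻¹ g)

@[simp]
theorem regRep_apply (a : A) (ξ : S.Space) (h : G) :
    S.regRep a ξ h = universalRep A (S.act h⁻¹ a) (ξ h) := rfl

@[simp]
theorem regShift_apply (g : G) (ξ : S.Space) (h : G) :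
    S.regShift g ξ h = universalRep A (S.cocycle h⁻¹ g) (ξ (g⁻¹ * h)) := rfl

theorem regShift_mul (g h : G) :
    S.regShift g * S.regShift h = S.regRep (S.cocycle g h) * S.regShift (g * h) := by
  ext ξ k
  simp only [mul_apply_eq_comp, regShift_apply, regRep_apply]
  rw [← mul_apply_eq_comp, ← mul_apply_eq_comp, ← map_mul, ← map_mul,
    mul_inv_rev, inv_inv, S.cocycle_mul, mul_inv_rev, mul_assoc]

theorem regShift_mul_regRep (g : G) (a : A) :
    S.regShift g * S.regRep a = S.regRep (S.act g a) * S.regShift g := by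
  ext ξ k
  simp only [mul_apply_eq_comp, regShift_apply, regRep_apply]
  rw [← mul_apply_eq_comp, ← mul_apply_eq_comp, ← map_mul, ← map_mul,
    S.act_act_mul_cocycle, mul_inv_rev, inv_inv]

theorem regShift_one : S.regShift 1 = 1 := by
  ext ξ k
  simp only [regShift_apply, S.cocycle_one_right, inv_one, one_mul, OneMemClass.coe_one, map_one,
    one_apply_eq_self]

theorem regRep_cocycle_isUnit (g h : G) : IsUnit (S.regRep (S.cocycle g h)) :=
  (Unitary.toUnits (S.cocycle g h)).isUnit.map S.regRep

theorem regShift_isUnit (g : G) : IsUnit (S.regShift g) := by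
  have h1 : S.regShift g * S.regShift g⁻¹ = S.regRep (S.cocycle g g⁻¹) := by
    rw [regShift_mul, mul_inv_cancel, regShift_one, mul_one]
  have h2 : S.regShift g⁻¹ * S.regShift g = S.regRep (S.cocycle g⁻¹ g) := by
    rw [regShift_mul, inv_mul_cancel, regShift_one, mul_one]
  obtain ⟨u, hu⟩ := S.regRep_cocycle_isUnit g g⁻¹
  obtain ⟨v, hv⟩ := S.regRep_cocycle_isUnit g⁻¹ g
  refine isUnit_iff_exists_and_exists.2 ⟨⟨S.regShift g⁻¹ * ↑u⁻¹, ?_⟩, ⟨↑v⁻¹ * S.regShift g⁻¹, ?_⟩⟩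
  · rw [← mul_assoc, h1, ← hu, Units.mul_inv]
  · rw [mul_assoc, h2, ← hv, Units.inv_mul]

theorem regShift_mul_star (g : G) : S.regShift g * star (S.regShift g) = 1 := by
  refine lpMap_comp_adjoint _ _ _ _ _ fun h => ?_
  rw [← ContinuousLinearMap.star_eq_adjoint, ← ContinuousLinearMap.mul_def, ← map_star, ← map_mul,
    Unitary.mul_star_self_of_mem (S.cocycle h⁻¹ g).2, map_one]

theorem star_regShift_mul (g : G) : star (S.regShift g) * S.regShift g = 1 := by
  obtain ⟨u, hu⟩ := S.regShift_isUnit g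
  have h := S.regShift_mul_star g
  rw [← hu] at h ⊢
  rw [show star (u : S.Space →L[ℂ] S.Space) = ↑u⁻¹ from
      (Units.inv_eq_of_mul_eq_one_right h).symm,
    Units.inv_mul]

theorem star_regShift (g : G) :
    star (S.regShift g) =
      S.regRep (S.act g⁻¹ (star (S.cocycle g g⁻¹ : A))) * S.regShift g⁻¹ := by
  have h1 : S.regShift g * S.regShift g⁻¹ = S.regRep (S.cocycle g g⁻¹) := by
    rw [regShift_mul, mul_inv_cancel, regShift_one, mul_one]
  rw [← regShift_mul_regRep]
  calc star (S.regShift g) = star (S.regShift g) *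
        (S.regRep (S.cocycle g g⁻¹) * S.regRep (star (S.cocycle g g⁻¹ : A))) := by
        rw [← map_mul, Unitary.mul_star_self_of_mem (S.cocycle g g⁻¹).2, map_one, mul_one]
    _ = _ := by rw [← h1, mul_assoc, ← mul_assoc (star _), star_regShift_mul, one_mul]

/-- The C⋆-algebra of operators on `ℓ²(G, H)` generated by `π(A)` and `λ(G)`. -/
def crossedSubalgebra : StarSubalgebra ℂ (S.Space →L[ℂ] S.Space) :=
  (StarAlgebra.adjoin ℂ (Set.range S.regRep ∪ Set.range S.regShift)).topologicalClosure

/-- The reduced twisted crossed product `C⋆_r(A, G, α, σ)`, realized through the regular covariant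
representation induced by a faithful representation of `A`. -/
def CrossedProduct : Type _ := S.crossedSubalgebra

instance : IsClosed (S.crossedSubalgebra : Set (S.Space →L[ℂ] S.Space)) :=
  StarSubalgebra.isClosed_topologicalClosure _

instance : CStarAlgebra (S.Space →L[ℂ] S.Space) where

instance : CStarAlgebra S.CrossedProduct :=
  (inferInstance : CStarAlgebra S.crossedSubalgebra)

/-- The inclusion of the crossed product in the bounded operators on `ℓ²(G, H)`. -/
def toOperator : S.CrossedProduct →⋆ₐ[ℂ] (S.Space →L[ℂ] S.Space) := S.crossedSubalgebra.subtype

theorem regRep_mem (a : A) : S.regRep a ∈ S.crossedSubalgebra :=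
  StarSubalgebra.le_topologicalClosure _ (StarAlgebra.subset_adjoin _ _ (Or.inl ⟨a, rfl⟩))

theorem regShift_mem (g : G) : S.regShift g ∈ S.crossedSubalgebra :=
  StarSubalgebra.le_topologicalClosure _ (StarAlgebra.subset_adjoin _ _ (Or.inr ⟨g, rfl⟩))

/-- The copy of `A` in the crossed product. -/
def incl : A →⋆ₐ[ℂ] S.CrossedProduct :=
  StarAlgHom.codRestrict S.regRep S.crossedSubalgebra S.regRep_mem

/-- The canonical unitary `λ(g)` in the crossed product. -/
def shift (g : G) : S.CrossedProduct := ⟨S.regShift g, S.regShift_mem g⟩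

/-- The finite sums `∑ a_g λ(g)`. -/
def finiteSums : Submodule ℂ (S.Space →L[ℂ] S.Space) :=
  Submodule.span ℂ (Set.range fun p : A × G => S.regRep p.1 * S.regShift p.2)

theorem finiteSums_mul {x y : S.Space →L[ℂ] S.Space} (hx : x ∈ S.finiteSums)
    (hy : y ∈ S.finiteSums) : x * y ∈ S.finiteSums := by
  induction hx, hy using Submodule.span_induction₂ with
  | mem_mem x y hx hy =>
    obtain ⟨⟨a, g⟩, rfl⟩ := hx
    obtain ⟨⟨b, h⟩, rfl⟩ := hy
    refine Submodule.subset_span ⟨(a * S.act g b * S.cocycle g h, g * h), ?_⟩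
    simp only [map_mul]
    rw [mul_assoc, mul_assoc, ← regShift_mul, ← mul_assoc (S.regRep (S.act g b)),
      ← regShift_mul_regRep]
    simp only [mul_assoc]
  | zero_left y hy => rw [zero_mul]; exact zero_mem _
  | zero_right x hx => rw [mul_zero]; exact zero_mem _
  | add_left x y z _ _ _ h1 h2 => rw [add_mul]; exact add_mem h1 h2
  | add_right x y z _ _ _ h1 h2 => rw [mul_add]; exact add_mem h1 h2
  | smul_left c x y _ _ h => rw [smul_mul_assoc]; exact Submodule.smul_mem _ c h
  | smul_right c x y _ _ h => rw [mul_smul_comm]; exact Submodule.smul_mem _ c h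

theorem finiteSums_star {x : S.Space →L[ℂ] S.Space} (hx : x ∈ S.finiteSums) :
    star x ∈ S.finiteSums := by
  induction hx using Submodule.span_induction with
  | mem x hx =>
    obtain ⟨⟨a, g⟩, rfl⟩ := hx
    rw [star_mul, star_regShift, ← map_star]
    refine S.finiteSums_mul (Submodule.subset_span ⟨(_, _), rfl⟩)
      (Submodule.subset_span ⟨(star a, 1), ?_⟩)
    simp only [regShift_one, mul_one]
  | zero => rw [star_zero]; exact zero_mem _
  | add x y _ _ h1 h2 => rw [star_add]; exact add_mem h1 h2
  | smul c x _ h => rw [star_smul]; exact Submodule.smul_mem _ _ h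

theorem crossedSubalgebra_le {x : S.Space →L[ℂ] S.Space} (hx : x ∈ S.crossedSubalgebra) :
    x ∈ S.finiteSums.topologicalClosure := by
  have hrep : ∀ a, S.regRep a ∈ S.finiteSums := fun a =>
    Submodule.subset_span ⟨(a, 1), by simp only [regShift_one, mul_one]⟩
  let D : StarSubalgebra ℂ (S.Space →L[ℂ] S.Space) :=
    { carrier := S.finiteSums
      mul_mem' := S.finiteSums_mul
      add_mem' := add_mem
      algebraMap_mem' := fun c => by
        rw [← AlgHomClass.commutes S.regRep]; exact hrep _
      star_mem' := S.finiteSums_star }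
  have h : StarAlgebra.adjoin ℂ (Set.range S.regRep ∪ Set.range S.regShift) ≤ D := by
    refine StarAlgebra.adjoin_le ?_
    rintro _ (⟨a, rfl⟩ | ⟨g, rfl⟩)
    · exact hrep a
    · exact Submodule.subset_span ⟨(1, g), by simp only [map_one, one_mul]⟩
  exact closure_mono h hx

/-- The compression of an operator on `ℓ²(G, H)` to the coordinate of the neutral element. -/
def compress : (S.Space →L[ℂ] S.Space) →L[ℂ] (UniversalSpace A →L[ℂ] UniversalSpace A) :=
  letI := Classical.decEq G
  (ContinuousLinearMap.compL ℂ (UniversalSpace A) S.Space (UniversalSpace A)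
      (lp.evalCLM ℂ (fun _ : G => UniversalSpace A) 2 1)) ∘L
    ((ContinuousLinearMap.compL ℂ (UniversalSpace A) S.Space S.Space).flip
      (lp.singleContinuousLinearMap ℂ (fun _ : G => UniversalSpace A) 2 1))

theorem compress_regRep_mul_regShift (a : A) (g : G) [Decidable (g = 1)] :
    S.compress (S.regRep a * S.regShift g) = if g = 1 then universalRep A a else 0 := by
  let _ := Classical.decEq G
  ext v
  change S.regRep a (S.regShift g (lp.single 2 1 v)) 1 = _
  rw [regRep_apply, regShift_apply, inv_one, S.cocycle_one_left, S.act_one, mul_one]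
  split_ifs with h
  · subst h
    rw [inv_one, lp.single_apply_self]
    simp
  · rw [lp.single_apply_ne _ _ _ (by simpa using h)]
    simp

theorem compress_mem {x : S.Space →L[ℂ] S.Space} (hx : x ∈ S.crossedSubalgebra) :
    S.compress x ∈ LinearMap.range (universalRep A).toAlgHom.toLinearMap := by
  classical
  have hclosed : IsClosed (LinearMap.range (universalRep A).toAlgHom.toLinearMap :
      Set (UniversalSpace A →L[ℂ] UniversalSpace A)) := by
    have := (NonUnitalStarAlgHom.isometry (universalRep A)
      universalRep_injective).isClosedEmbedding.isClosed_range
    exact this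
  have h : S.finiteSums.topologicalClosure ≤
      (LinearMap.range (universalRep A).toAlgHom.toLinearMap).comap S.compress.toLinearMap := by
    refine Submodule.topologicalClosure_minimal _ (Submodule.span_le.2 ?_)
      (hclosed.preimage S.compress.continuous)
    rintro _ ⟨⟨a, g⟩, rfl⟩
    change S.compress (S.regRep a * S.regShift g) ∈
      LinearMap.range (universalRep A).toAlgHom.toLinearMap
    rw [compress_regRep_mul_regShift]
    split_ifs
    · exact ⟨a, rfl⟩
    · exact zero_mem _
  exact h (S.crossedSubalgebra_le hx)

/-- The canonical conditional expectation `E` from the crossed product to `A`: the element `E(x)`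
acts on `H` as the compression of `x` to the coordinate of the neutral element. -/
def condExp : S.CrossedProduct →ₗ[ℂ] A :=
  (LinearEquiv.ofInjective (universalRep A).toAlgHom.toLinearMap
      universalRep_injective).symm.toLinearMap ∘ₗ
    (S.compress.toLinearMap ∘ₗ S.toOperator.toAlgHom.toLinearMap).codRestrict _
      (fun x => S.compress_mem x.2)

theorem universalRep_condExp (x : S.CrossedProduct) :
    universalRep A (S.condExp x) = S.compress (S.toOperator x) :=
  congrArg Subtype.val (LinearEquiv.apply_symm_apply
    (LinearEquiv.ofInjective (universalRep A).toAlgHom.toLinearMap universalRep_injective) _)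

theorem condExp_incl_mul_shift (a : A) (g : G) [Decidable (g = 1)] :
    S.condExp (S.incl a * S.shift g) = if g = 1 then a else 0 := by
  apply universalRep_injective
  rw [universalRep_condExp]
  refine (S.compress_regRep_mul_regShift a g).trans ?_
  split_ifs <;> simp

end TwistedAction

namespace ClosedIdeal

variable {A B : Type*} [CStarAlgebra A] [CStarAlgebra B] (J : ClosedIdeal A)

theorem proj_surjective : Function.Surjective J.proj := J.mkAlg_surjective

theorem proj_eq_zero_iff {a : A} : J.proj a = 0 ↔ a ∈ J := J.mkAlg_eq_zero_iff

/-- A ⋆-homomorphism vanishing on `J` factors through `A / J`. -/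
def lift (φ : A →⋆ₐ[ℂ] B) (h : ∀ a ∈ J, φ a = 0) : J.Quotient →⋆ₐ[ℂ] B where
  __ := (Ideal.Quotient.liftₐ J.ideal.asIdeal φ.toAlgHom h : A ⧸ J.ideal.asIdeal →ₐ[ℂ] B)
  map_star' x := by
    obtain ⟨a, rfl⟩ := J.mkAlg_surjective x
    exact map_star φ a

@[simp]
theorem lift_proj (φ : A →⋆ₐ[ℂ] B) (h : ∀ a ∈ J, φ a = 0) (a : A) :
    J.lift φ h (J.proj a) = φ a := rfl

/-- The automorphism of `A / J` induced by an automorphism `e` of `A` with `e(J) = J`. -/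
def quotientAut (e : A ≃⋆ₐ[ℂ] A) (he : ∀ a, e a ∈ J ↔ a ∈ J) : J.Quotient ≃⋆ₐ[ℂ] J.Quotient :=
  StarAlgEquiv.ofBijective
    (J.lift (J.proj.comp (e : A →⋆ₐ[ℂ] A)) fun a ha => J.proj_eq_zero_iff.2 ((he a).2 ha))
    ⟨by
      rw [injective_iff_map_eq_zero]
      intro x hx
      obtain ⟨a, rfl⟩ := J.proj_surjective x
      exact J.proj_eq_zero_iff.2 ((he a).1 (J.proj_eq_zero_iff.1 hx)), fun y => by
      obtain ⟨b, rfl⟩ := J.proj_surjective y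
      obtain ⟨a, rfl⟩ := EquivLike.surjective e b
      exact ⟨J.proj a, rfl⟩⟩

@[simp]
theorem quotientAut_proj (e : A ≃⋆ₐ[ℂ] A) (he : ∀ a, e a ∈ J ↔ a ∈ J) (a : A) :
    J.quotientAut e he (J.proj a) = J.proj (e a) := rfl

section GNS

attribute [local instance] CStarAlgebra.spectralOrder CStarAlgebra.spectralOrderedRing

/-- The pullback to `A` of a positive functional on `A / J`. -/
def pullback (f : J.Quotient →ₚ[ℂ] ℂ) : A →ₚ[ℂ] ℂ :=
  f.comp (PositiveLinearMap.ofClass J.proj)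

theorem pullback_apply (f : J.Quotient →ₚ[ℂ] ℂ) (a : A) : J.pullback f a = f (J.proj a) := rfl

theorem pullback_injective : Function.Injective J.pullback := fun f g h => by
  ext x
  obtain ⟨a, rfl⟩ := J.proj_surjective x
  rw [← pullback_apply, h, pullback_apply]

/-- The isometry `a ↦ a + J` between the pre-Hilbert spaces of a functional and its pullback. -/
def preGNSProj (f : J.Quotient →ₚ[ℂ] ℂ) : (J.pullback f).PreGNS →ₗᵢ[ℂ] f.PreGNS where
  toLinearMap :=
    f.toPreGNS.toLinearMap ∘ₗ J.proj.toAlgHom.toLinearMap ∘ₗ (J.pullback f).ofPreGNS.toLinearMap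
  norm_map' a := by
    rw [PositiveLinearMap.preGNS_norm_def, PositiveLinearMap.preGNS_norm_def, pullback_apply,
      map_mul J.proj, map_star J.proj]
    rfl

/-- The unitary between the Hilbert spaces of a functional on `A / J` and of its pullback. -/
def gnsProj (f : J.Quotient →ₚ[ℂ] ℂ) : (J.pullback f).GNS →L[ℂ] f.GNS :=
  (J.preGNSProj f).toContinuousLinearMap.completion

theorem gnsProj_coe (f : J.Quotient →ₚ[ℂ] ℂ) (a : (J.pullback f).PreGNS) :
    J.gnsProj f (a : (J.pullback f).GNS) = (J.preGNSProj f a : f.GNS) :=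
  ContinuousLinearMap.completion_apply_coe _ _

theorem norm_gnsProj (f : J.Quotient →ₚ[ℂ] ℂ) (ξ : (J.pullback f).GNS) :
    ‖J.gnsProj f ξ‖ = ‖ξ‖ := by
  induction ξ using UniformSpace.Completion.induction_on with
  | hp => exact isClosed_eq (J.gnsProj f).continuous.norm continuous_norm
  | ih a =>
    rw [gnsProj_coe, UniformSpace.Completion.norm_coe, UniformSpace.Completion.norm_coe,
      LinearIsometry.norm_map]

theorem gnsProj_surjective (f : J.Quotient →ₚ[ℂ] ℂ) : Function.Surjective (J.gnsProj f) := by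
  have hiso : Isometry (J.gnsProj f) := AddMonoidHomClass.isometry_of_norm _ (J.norm_gnsProj f)
  have hcl := hiso.isClosedEmbedding.isClosed_range
  intro η
  induction η using UniformSpace.Completion.induction_on with
  | hp => exact hcl
  | ih b =>
    obtain ⟨a, ha⟩ := J.proj_surjective (f.ofPreGNS b)
    refine ⟨((J.pullback f).toPreGNS a : (J.pullback f).PreGNS), ?_⟩
    rw [gnsProj_coe]
    have h : J.preGNSProj f ((J.pullback f).toPreGNS a) = b := by
      change f.toPreGNS (J.proj a) = b
      rw [ha, PositiveLinearMap.toPreGNS_ofPreGNS]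
    rw [h]

open ContinuousLinearMap in
theorem gnsProj_comp_adjoint (f : J.Quotient →ₚ[ℂ] ℂ) :
    J.gnsProj f ∘L adjoint (J.gnsProj f) = 1 := by
  have h : adjoint (J.gnsProj f) ∘L J.gnsProj f = 1 :=
    (ContinuousLinearMap.norm_map_iff_adjoint_comp_self _).1 (J.norm_gnsProj f)
  ext1 η
  obtain ⟨ξ, rfl⟩ := J.gnsProj_surjective f η
  exact congrArg (J.gnsProj f) (DFunLike.congr_fun h ξ)

theorem gnsProj_gns (f : J.Quotient →ₚ[ℂ] ℂ) (a : A) (ξ : (J.pullback f).GNS) :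
    J.gnsProj f ((J.pullback f).gnsStarAlgHom a ξ) = f.gnsStarAlgHom (J.proj a) (J.gnsProj f ξ) := by
  induction ξ using UniformSpace.Completion.induction_on with
  | hp =>
    exact isClosed_eq
      ((J.gnsProj f).continuous.comp ((J.pullback f).gnsStarAlgHom a).continuous)
      ((f.gnsStarAlgHom (J.proj a)).continuous.comp (J.gnsProj f).continuous)
  | ih b =>
    have h1 := (J.pullback f).gnsNonUnitalStarAlgHom_apply_coe (a := a) (b := b)
    have h2 := f.gnsNonUnitalStarAlgHom_apply_coe (a := J.proj a) (b := J.preGNSProj f b)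
    change J.gnsProj f ((J.pullback f).gnsNonUnitalStarAlgHom a b) =
      f.gnsNonUnitalStarAlgHom (J.proj a) (J.gnsProj f b)
    rw [h1, gnsProj_coe, gnsProj_coe, h2]
    have h3 : J.preGNSProj f ((J.pullback f).leftMulMapPreGNS a b) =
        f.leftMulMapPreGNS (J.proj a) (J.preGNSProj f b) := by
      change f.toPreGNS (J.proj (a * (J.pullback f).ofPreGNS b)) =
        f.toPreGNS (J.proj a * J.proj ((J.pullback f).ofPreGNS b))
      rw [map_mul]
    rw [h3]

theorem norm_gnsProj_le (f : J.Quotient →ₚ[ℂ] ℂ) : ‖J.gnsProj f‖ ≤ 1 :=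
  ContinuousLinearMap.opNorm_le_bound _ zero_le_one fun ξ => by rw [norm_gnsProj, one_mul]

/-- The coisometry from the universal Hilbert space of `A` onto that of `A / J`. -/
def univProj : UniversalSpace A →L[ℂ] UniversalSpace J.Quotient :=
  lpMap J.pullback J.pullback_injective J.gnsProj 1 J.norm_gnsProj_le

open ContinuousLinearMap in
theorem univProj_comp_adjoint : J.univProj ∘L adjoint J.univProj = 1 :=
  lpMap_comp_adjoint _ _ _ _ _ J.gnsProj_comp_adjoint

theorem univProj_rep (a : A) (ξ : UniversalSpace A) :
    J.univProj (universalRep A a ξ) = universalRep J.Quotient (J.proj a) (J.univProj ξ) := by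
  refine lp.ext (funext fun f => ?_)
  exact J.gnsProj_gns f a _

end GNS

end ClosedIdeal

namespace TwistedAction

variable {A G : Type*} [CStarAlgebra A] [Group G] (S : TwistedAction A G)

/-- The ideal `J` of `A` is invariant: `α_g(J) = J` for all `g`. -/
def IsInvariant (J : ClosedIdeal A) : Prop := ∀ g a, S.act g a ∈ J ↔ a ∈ J

/-- The twisted action on `A / J` induced by a twisted action on `A`. -/
def quotient (J : ClosedIdeal A) (hJ : S.IsInvariant J) : TwistedAction J.Quotient G where
  act g := J.quotientAut (S.act g) (hJ g)
  cocycle g h := ⟨J.proj (S.cocycle g h), Unitary.map_mem J.proj (S.cocycle g h).2⟩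
  act_act g h x := by
    obtain ⟨a, rfl⟩ := J.proj_surjective x
    simp only [ClosedIdeal.quotientAut_proj, ← map_star, ← map_mul, S.act_act]
  cocycle_mul g h k := by
    simp only [ClosedIdeal.quotientAut_proj, ← map_mul, S.cocycle_mul]
  cocycle_one_right g := by
    ext
    simp only [S.cocycle_one_right, OneMemClass.coe_one, map_one]
  cocycle_one_left g := by
    ext
    simp only [S.cocycle_one_left, OneMemClass.coe_one, map_one]

variable (J : ClosedIdeal A) (hJ : S.IsInvariant J)

/-- The coisometry `ℓ²(G, H) → ℓ²(G, K)` applying the coisometry between the universal Hilbert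
spaces of `A` and `A / J` in each coordinate. -/
def spaceProj : S.Space →L[ℂ] (S.quotient J hJ).Space :=
  lpMap id Function.injective_id (fun _ : G => J.univProj) ‖J.univProj‖ fun _ => le_rfl

@[simp]
theorem spaceProj_apply (ξ : S.Space) (h : G) :
    S.spaceProj J hJ ξ h = J.univProj (ξ h) := rfl

open ContinuousLinearMap in
theorem spaceProj_comp_adjoint : S.spaceProj J hJ ∘L adjoint (S.spaceProj J hJ) = 1 :=
  lpMap_comp_adjoint _ _ _ _ _ fun _ => J.univProj_comp_adjoint

theorem spaceProj_comp_regRep (a : A) :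
    S.spaceProj J hJ ∘L S.regRep a = (S.quotient J hJ).regRep (J.proj a) ∘L S.spaceProj J hJ := by
  ext1 ξ
  exact lp.ext (funext fun h => J.univProj_rep _ _)

theorem spaceProj_comp_regShift (g : G) :
    S.spaceProj J hJ ∘L S.regShift g = (S.quotient J hJ).regShift g ∘L S.spaceProj J hJ := by
  ext1 ξ
  exact lp.ext (funext fun h => J.univProj_rep _ _)

open ContinuousLinearMap in
/-- The compression of operators on `ℓ²(G, H)` to `ℓ²(G, K)`. -/
def quotientCompress :
    (S.Space →L[ℂ] S.Space) →L[ℂ] ((S.quotient J hJ).Space →L[ℂ] (S.quotient J hJ).Space) :=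
  (compL ℂ (S.quotient J hJ).Space S.Space (S.quotient J hJ).Space (S.spaceProj J hJ)) ∘L
    (compL ℂ (S.quotient J hJ).Space S.Space S.Space).flip (adjoint (S.spaceProj J hJ))

open ContinuousLinearMap in
theorem quotientCompress_apply (x : S.Space →L[ℂ] S.Space) :
    S.quotientCompress J hJ x = S.spaceProj J hJ ∘L x ∘L adjoint (S.spaceProj J hJ) := rfl

theorem quotientCompress_eq {x : S.Space →L[ℂ] S.Space}
    {y : (S.quotient J hJ).Space →L[ℂ] (S.quotient J hJ).Space}
    (h : S.spaceProj J hJ ∘L x = y ∘L S.spaceProj J hJ) : S.quotientCompress J hJ x = y := by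
  rw [quotientCompress_apply, ← ContinuousLinearMap.comp_assoc, h, ContinuousLinearMap.comp_assoc,
    spaceProj_comp_adjoint]
  rfl

theorem quotientCompress_regRep (a : A) :
    S.quotientCompress J hJ (S.regRep a) = (S.quotient J hJ).regRep (J.proj a) :=
  S.quotientCompress_eq J hJ (S.spaceProj_comp_regRep J hJ a)

theorem quotientCompress_regShift (g : G) :
    S.quotientCompress J hJ (S.regShift g) = (S.quotient J hJ).regShift g :=
  S.quotientCompress_eq J hJ (S.spaceProj_comp_regShift J hJ g)

theorem quotientCompress_star (x : S.Space →L[ℂ] S.Space) :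
    S.quotientCompress J hJ (star x) = star (S.quotientCompress J hJ x) := by
  rw [quotientCompress_apply, quotientCompress_apply]
  generalize S.spaceProj J hJ = V
  rw [ContinuousLinearMap.star_eq_adjoint, ContinuousLinearMap.star_eq_adjoint,
    ContinuousLinearMap.adjoint_comp, ContinuousLinearMap.adjoint_comp,
    ContinuousLinearMap.adjoint_adjoint, ContinuousLinearMap.comp_assoc]

theorem spaceProj_comp_star_regShift (g : G) :
    S.spaceProj J hJ ∘L star (S.regShift g)
      = star ((S.quotient J hJ).regShift g) ∘L S.spaceProj J hJ := by
  have h1 := (S.quotient J hJ).star_regShift_mul g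
  have h2 := S.regShift_mul_star g
  rw [ContinuousLinearMap.mul_def] at h1 h2
  calc S.spaceProj J hJ ∘L star (S.regShift g)
      = (star ((S.quotient J hJ).regShift g) ∘L (S.quotient J hJ).regShift g) ∘L
          S.spaceProj J hJ ∘L star (S.regShift g) := by rw [h1]; rfl
    _ = star ((S.quotient J hJ).regShift g) ∘L ((S.quotient J hJ).regShift g ∘L
          S.spaceProj J hJ) ∘L star (S.regShift g) := by
        simp only [ContinuousLinearMap.comp_assoc]
    _ = star ((S.quotient J hJ).regShift g) ∘L S.spaceProj J hJ ∘L
          S.regShift g ∘L star (S.regShift g) := by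
        rw [← spaceProj_comp_regShift]; simp only [ContinuousLinearMap.comp_assoc]
    _ = _ := by rw [h2]; rfl

theorem quotientCompress_spec {x : S.Space →L[ℂ] S.Space} (hx : x ∈ S.crossedSubalgebra) :
    S.spaceProj J hJ ∘L x = S.quotientCompress J hJ x ∘L S.spaceProj J hJ ∧
      S.quotientCompress J hJ x ∈ (S.quotient J hJ).crossedSubalgebra := by
  set V := S.spaceProj J hJ with hV
  set Φ := S.quotientCompress J hJ with hΦ
  have hmul : ∀ {x y}, V ∘L x = Φ x ∘L V → V ∘L y = Φ y ∘L V → V ∘L (x * y) = (Φ x * Φ y) ∘L V :=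
    fun {x y} hx hy => by
      rw [ContinuousLinearMap.mul_def, ContinuousLinearMap.mul_def, ← ContinuousLinearMap.comp_assoc,
        hx, ContinuousLinearMap.comp_assoc, hy, ContinuousLinearMap.comp_assoc]
  have hone : ∀ c : ℂ, V ∘L (algebraMap ℂ _ c) = (algebraMap ℂ _ c) ∘L V := fun c => by
    ext1 ξ
    simp [Algebra.algebraMap_eq_smul_one]
  let D : StarSubalgebra ℂ (S.Space →L[ℂ] S.Space) :=
    { carrier := {x | (V ∘L x = Φ x ∘L V ∧ V ∘L star x = Φ (star x) ∘L V) ∧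
        Φ x ∈ (S.quotient J hJ).crossedSubalgebra}
      mul_mem' := by
        rintro x y ⟨⟨h1, h2⟩, h3⟩ ⟨⟨h4, h5⟩, h6⟩
        have h7 : Φ (x * y) = Φ x * Φ y := S.quotientCompress_eq J hJ (hmul h1 h4)
        have h8 : Φ (star y * star x) = Φ (star y) * Φ (star x) :=
          S.quotientCompress_eq J hJ (hmul h5 h2)
        refine ⟨⟨?_, ?_⟩, ?_⟩
        · rw [h7]; exact hmul h1 h4
        · rw [star_mul, h8]; exact hmul h5 h2
        · rw [h7]; exact mul_mem h3 h6
      add_mem' := by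
        rintro x y ⟨⟨h1, h2⟩, h3⟩ ⟨⟨h4, h5⟩, h6⟩
        refine ⟨⟨?_, ?_⟩, ?_⟩
        · rw [map_add, ContinuousLinearMap.comp_add, h1, h4, ContinuousLinearMap.add_comp]
        · rw [star_add, map_add, ContinuousLinearMap.comp_add, h2, h5,
            ContinuousLinearMap.add_comp]
        · rw [map_add]; exact add_mem h3 h6
      algebraMap_mem' := fun c => by
        have h1 : ∀ c : ℂ, Φ (algebraMap ℂ _ c) = algebraMap ℂ _ c := fun c =>
          S.quotientCompress_eq J hJ (hone c)
        refine ⟨⟨?_, ?_⟩, ?_⟩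
        · rw [h1]; exact hone c
        · rw [← algebraMap_star_comm, h1]; exact hone _
        · rw [h1]; exact algebraMap_mem _ c
      star_mem' := by
        rintro x ⟨⟨h1, h2⟩, h3⟩
        refine ⟨⟨h2, by rw [star_star]; exact h1⟩, ?_⟩
        rw [hΦ, quotientCompress_star]
        exact star_mem h3 }
  have hL : Continuous fun x : S.Space →L[ℂ] S.Space => V ∘L x :=
    continuous_const.clm_comp continuous_id
  have hR : Continuous fun y : (S.quotient J hJ).Space →L[ℂ] (S.quotient J hJ).Space => y ∘L V :=
    continuous_id.clm_comp continuous_const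
  have hD : IsClosed (D : Set (S.Space →L[ℂ] S.Space)) := by
    refine IsClosed.inter (IsClosed.inter ?_ ?_) ?_
    · exact isClosed_eq hL (hR.comp Φ.continuous)
    · exact isClosed_eq (hL.comp continuous_star) (hR.comp (Φ.continuous.comp continuous_star))
    · exact IsClosed.preimage Φ.continuous (StarSubalgebra.isClosed_topologicalClosure _)
  have hle : S.crossedSubalgebra ≤ D := by
    refine StarSubalgebra.topologicalClosure_minimal (StarAlgebra.adjoin_le ?_) hD
    rintro _ (⟨a, rfl⟩ | ⟨g, rfl⟩)
    · refine ⟨⟨?_, ?_⟩, ?_⟩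
      · rw [hΦ, quotientCompress_regRep]; exact S.spaceProj_comp_regRep J hJ a
      · rw [← map_star, hΦ, quotientCompress_regRep]; exact S.spaceProj_comp_regRep J hJ _
      · rw [hΦ, quotientCompress_regRep]; exact regRep_mem _ _
    · refine ⟨⟨?_, ?_⟩, ?_⟩
      · rw [hΦ, quotientCompress_regShift]; exact S.spaceProj_comp_regShift J hJ g
      · rw [hΦ, quotientCompress_star, quotientCompress_regShift]
        exact S.spaceProj_comp_star_regShift J hJ g
      · rw [hΦ, quotientCompress_regShift]; exact regShift_mem _ _
  exact ⟨(hle hx).1.1, (hle hx).2⟩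

theorem quotientCompress_mul {x y : S.Space →L[ℂ] S.Space} (hx : x ∈ S.crossedSubalgebra)
    (hy : y ∈ S.crossedSubalgebra) :
    S.quotientCompress J hJ (x * y) = S.quotientCompress J hJ x * S.quotientCompress J hJ y :=
  S.quotientCompress_eq J hJ (by
    rw [ContinuousLinearMap.mul_def, ContinuousLinearMap.mul_def,
      ← ContinuousLinearMap.comp_assoc, (S.quotientCompress_spec J hJ hx).1,
      ContinuousLinearMap.comp_assoc, (S.quotientCompress_spec J hJ hy).1,
      ContinuousLinearMap.comp_assoc])

theorem quotientCompress_algebraMap (c : ℂ) :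
    S.quotientCompress J hJ (algebraMap ℂ _ c) = algebraMap ℂ _ c :=
  S.quotientCompress_eq J hJ (by
    ext1 ξ
    simp [Algebra.algebraMap_eq_smul_one])

/-- The canonical ⋆-homomorphism from the reduced crossed product of `A` to that of `A / J`; it
is determined by `quotientHom_incl` and `quotientHom_shift`. -/
def quotientHom : S.CrossedProduct →⋆ₐ[ℂ] (S.quotient J hJ).CrossedProduct where
  toFun x := ⟨S.quotientCompress J hJ (S.toOperator x), (S.quotientCompress_spec J hJ x.2).2⟩
  map_one' := Subtype.ext (S.quotientCompress_eq J hJ rfl)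
  map_mul' x y := Subtype.ext (S.quotientCompress_mul J hJ x.2 y.2)
  map_zero' := Subtype.ext (map_zero (S.quotientCompress J hJ))
  map_add' x y := Subtype.ext (map_add (S.quotientCompress J hJ) (S.toOperator x) (S.toOperator y))
  commutes' c := Subtype.ext (S.quotientCompress_algebraMap J hJ c)
  map_star' x := Subtype.ext (S.quotientCompress_star J hJ (S.toOperator x))

theorem quotientHom_incl (a : A) :
    S.quotientHom J hJ (S.incl a) = (S.quotient J hJ).incl (J.proj a) :=
  Subtype.ext (S.quotientCompress_regRep J hJ a)

theorem quotientHom_shift (g : G) :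
    S.quotientHom J hJ (S.shift g) = (S.quotient J hJ).shift g :=
  Subtype.ext (S.quotientCompress_regShift J hJ g)

end TwistedAction

namespace ClosedIdeal

variable {A : Type*} [CStarAlgebra A]

/-- The closed two-sided ideal generated by a set, i.e. the smallest one containing it. -/
def generatedBy (s : Set A) : ClosedIdeal A where
  ideal := sInf {I : TwoSidedIdeal A | IsClosed (I : Set A) ∧ s ⊆ I}
  isClosed := by
    have h : ((sInf {I : TwoSidedIdeal A | IsClosed (I : Set A) ∧ s ⊆ I} : TwoSidedIdeal A) :
        Set A) = ⋂ I ∈ {I : TwoSidedIdeal A | IsClosed (I : Set A) ∧ s ⊆ I}, (I : Set A) := by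
      ext x
      simp only [SetLike.mem_coe, TwoSidedIdeal.mem_sInf, Set.mem_iInter]
    rw [h]
    exact isClosed_biInter fun I hI => hI.1

/-- `K` is maximal among the proper closed two-sided ideals. -/
def IsMaximal (K : ClosedIdeal A) : Prop := Maximal IsProper K

end ClosedIdeal

/-- `D` is a simple C⋆-algebra: it is nonzero and has no closed two-sided ideals besides `{0}` and
`D`. -/
def IsSimpleCStarAlgebra (D : Type*) [CStarAlgebra D] : Prop :=
  Nontrivial D ∧ ∀ K : ClosedIdeal D, (∀ x ∈ K, x = 0) ∨ ∀ x, x ∈ K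

/-- Tracial states of a unital C⋆-algebra. -/
structure IsTracialState {A : Type*} [CStarAlgebra A] (φ : A →ₗ[ℂ] ℂ) : Prop where
  nonneg : ∀ a, 0 ≤ φ (star a * a)
  map_one : φ 1 = 1
  tracial : ∀ a b, φ (a * b) = φ (b * a)

namespace TwistedAction

variable {A G : Type*} [CStarAlgebra A] [Group G] (S : TwistedAction A G)

/-- The functional `φ` on `A` is invariant: `φ ∘ α_g = φ` for all `g`. -/
def IsInvariantFunctional (φ : A →ₗ[ℂ] ℂ) : Prop := ∀ g a, φ (S.act g a) = φ a

/-- `J` is maximal among the proper invariant ideals of `A`. -/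
def IsMaximalInvariant (J : ClosedIdeal A) : Prop :=
  Maximal (fun I : ClosedIdeal A => I.IsProper ∧ S.IsInvariant I) J

/-- The ideal `⟨J⟩` of the reduced crossed product generated by (the copy of) `J`. -/
def inducedIdeal (J : ClosedIdeal A) : ClosedIdeal S.CrossedProduct :=
  ClosedIdeal.generatedBy (S.incl '' J)

/-- The system is exact: for every invariant ideal `J`, the ideal `⟨J⟩` is the kernel of the
canonical ⋆-homomorphism from the reduced crossed product of `A` to that of `A / J`. -/
def IsExact : Prop :=
  ∀ (J : ClosedIdeal A) (hJ : S.IsInvariant J) (x : S.CrossedProduct),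
    x ∈ S.inducedIdeal J ↔ S.quotientHom J hJ x = 0

end TwistedAction

section Groups

variable {G : Type*} [Group G]

/-- `T` is `M`-large in `G`: `m (G ∖ T) ⊆ T` for all `m ∈ M`. -/
def IsLarge (M T : Set G) : Prop := ∀ m ∈ M, ∀ x ∉ T, m * x ∈ T

/-- `H` is a Powers set for `F`. -/
def IsPowersSet (F H : Set G) : Prop :=
  ∀ N : ℕ, ∃ (h : Fin N → G) (T : Fin N → Set G), (∀ j, h j ∈ H) ∧
    (∀ i j, i ≠ j → Disjoint (T i) (T j)) ∧
    ∀ j, IsLarge ((fun f => h j * f * (h j)⁻¹) '' F) (T j)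

/-- `H` is a c-Powers set for `g`: it is a Powers set for `{a g a⁻¹ | a ∈ M}`, for all finite
nonempty subsets `M` of `H`. -/
def IsCPowersSet (g : G) (H : Set G) : Prop :=
  ∀ M : Set G, M.Finite → M.Nonempty → M ⊆ H → IsPowersSet ((fun a => a * g * a⁻¹) '' M) H

variable (G)

/-- PH groups, with chains of subgroups. -/
def IsPHGroup : Prop :=
  ∀ F : Finset G, F.Nonempty → (1 : G) ∉ F →
    ∃ (n : ℕ) (f : Fin n → G) (K : Fin n → Subgroup G), Function.Injective f ∧
      Set.range f = (F : Set G) ∧ Monotone K ∧ ∀ j, IsCPowersSet (f j) (K j : Set G)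

/-- Property `(P_com)` of Bekka, Cowling and de la Harpe. -/
def HasPropertyPcom : Prop :=
  ∀ F : Finset G, F.Nonempty → (1 : G) ∉ F →
    ∃ (n : ℕ) (g₀ : G) (U : Set G) (D : Fin n → Set G),
      Uᶜ ⊆ ⋃ k, D k ∧
      (∀ g ∈ F, Disjoint ((fun x => g * x) '' U) U) ∧
      ∀ j : ℕ, 1 ≤ j → ∀ k, Disjoint ((fun x => (g₀ ^ j)⁻¹ * x) '' D k) (D k)

/-- The class `𝒫` of groups that are PH groups or have property `(P_com)`. -/
def IsClassP : Prop := IsPHGroup G ∨ HasPropertyPcom G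

end Groups

end

/-!
The proof rests on an averaging property: if `G` is in the class `𝒫` and `E(x) = 0`, then suitable
iterated averages `ψ(x)` of conjugates `λ(h) x λ(h)⋆` have arbitrarily small norm
(`TwistedAction.exists_isIteratedAverage_norm_lt`).

By density, `x` may be taken to be a finite sum `∑ a_g λ(g)` over `g ≠ e`. The operator `λ(h) x λ(h)⋆`
moves supports by elements of `h F h⁻¹`, where `F` is the support of `x`. If `T ⊆ G` is
`h F h⁻¹`-large, it therefore maps vectors vanishing on `T` to vectors supported in `T`, and its
matrix coefficients are controlled by the projection `P_T`. If `N` such operators come with sets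
`T_j` of which at most `n` contain any given point, then Cauchy-Schwarz bounds the norm of their sum
by a multiple of `√(N n)` (`norm_sum_le_of_vanishing`), so that averages tend to zero. The
coefficients `a_g` and the cocycle play no role here. A Powers set gives disjoint sets, `n = 1`; in
property `(P_com)` the translates of `G ∖ U` by powers of `g₀` overlap at most `n` times. For PH
groups the terms of `x` are made small one after the other: the averages used so far are taken over
a subgroup contained in the next `G_j`, and spread the support of the next term over finitely many
conjugates of `f_j`, for which `G_j` is still a Powers set.

Tracial states are bounded and invariant under averaging, hence they vanish on the kernel of `E`,
which means that they factor through `E`. The converse needs that `E` is positive, `A`-bilinear and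
equivariant.

If `K` is a proper ideal of the crossed product, then the closure `J` of `E(K)` is an invariant ideal
of `A`. It is proper: otherwise `K` contains `y` with `E(y) = 1`, and then an average of `y`, which
lies in `K`, is at distance less than `1` from `1`, hence invertible. As the conditional expectation
of the quotient system is faithful, `K ⊆ ker q_J`. Thus every proper ideal is contained in `ker q_J`
for a proper invariant ideal `J`. Since `J ↦ ker q_J` is an order embedding, this identifies the
maximal ideals with the ideals `ker q_J` for `J` maximal invariant; exactness is used only to rewrite
`ker q_J` as `⟨J⟩`. The simple quotients are the quotients by maximal ideals.
-/

noncomputable section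

/-! ### Sums of operators concentrated near slowly overlapping sets of coordinates -/

section CoordinateProjections

variable {ι : Type*} {E : ι → Type*} [∀ i, NormedAddCommGroup (E i)]

theorem lp_hasSum_norm_sq (ξ : lp E 2) : HasSum (fun i => ‖ξ i‖ ^ 2) (‖ξ‖ ^ 2) := by
  have h := lp.hasSum_norm (p := 2) (by norm_num) ξ
  simpa using h

variable [∀ i, InnerProductSpace ℂ (E i)]

open scoped Classical in
/-- The orthogonal projection of a Hilbert space direct sum onto the vectors supported in `T`. -/
def coordProj (T : Set ι) : lp E 2 →L[ℂ] lp E 2 :=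
  lpMap id Function.injective_id (fun i => if i ∈ T then ContinuousLinearMap.id ℂ (E i) else 0) 1
    fun i => by
      split_ifs
      · exact ContinuousLinearMap.norm_id_le
      · simp

open scoped Classical in
theorem coordProj_apply (T : Set ι) (ξ : lp E 2) (i : ι) :
    coordProj T ξ i = if i ∈ T then ξ i else 0 := by
  rw [coordProj, lpMap_apply]
  split_ifs <;> rfl

theorem coordProj_apply_of_mem {T : Set ι} {i : ι} (hi : i ∈ T) (ξ : lp E 2) :
    coordProj T ξ i = ξ i := by
  rw [coordProj_apply, if_pos hi]

theorem coordProj_apply_of_notMem {T : Set ι} {i : ι} (hi : i ∉ T) (ξ : lp E 2) :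
    coordProj T ξ i = 0 := by
  rw [coordProj_apply, if_neg hi]

theorem coordProj_add_compl (T : Set ι) (ξ : lp E 2) :
    coordProj T ξ + coordProj Tᶜ ξ = ξ := by
  refine lp.ext (funext fun i => ?_)
  rw [lp.coeFn_add, Pi.add_apply]
  by_cases hi : i ∈ T
  · rw [coordProj_apply_of_mem hi, coordProj_apply_of_notMem (by simpa using hi), add_zero]
  · rw [coordProj_apply_of_notMem hi, coordProj_apply_of_mem (by simpa using hi), zero_add]

/-- If no coordinate lies in more than `n` of the sets `T_j`, then the projections onto these sets
satisfy `∑ ‖P_j ξ‖² ≤ n ‖ξ‖²`. -/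
theorem sum_norm_coordProj_sq_le {N n : ℕ} (T : Fin N → Set ι)
    (hT : ∀ i, Set.ncard {j | i ∈ T j} ≤ n) (ξ : lp E 2) :
    ∑ j, ‖coordProj (T j) ξ‖ ^ 2 ≤ n * ‖ξ‖ ^ 2 := by
  classical
  refine hasSum_le (fun i => ?_) (hasSum_sum fun j _ => lp_hasSum_norm_sq (coordProj (T j) ξ))
    ((lp_hasSum_norm_sq ξ).mul_left (n : ℝ))
  have h1 : ∀ j, ‖coordProj (T j) ξ i‖ ^ 2 = if i ∈ T j then ‖ξ i‖ ^ 2 else 0 := fun j => by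
    rw [coordProj_apply]
    split_ifs <;> simp
  simp only [h1]
  rw [← Finset.sum_filter, Finset.sum_const, nsmul_eq_mul]
  refine mul_le_mul_of_nonneg_right ?_ (by positivity)
  have h2 := hT i
  rw [Set.ncard_eq_toFinset_card'] at h2
  simp only [Set.toFinset_ofPred] at h2
  exact_mod_cast h2

theorem sum_norm_coordProj_le {N n : ℕ} (T : Fin N → Set ι)
    (hT : ∀ i, Set.ncard {j | i ∈ T j} ≤ n) (ξ : lp E 2) :
    ∑ j, ‖coordProj (T j) ξ‖ ≤ √(N * n) * ‖ξ‖ := by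
  have h1 := sq_sum_le_card_mul_sum_sq (s := Finset.univ) (f := fun j => ‖coordProj (T j) ξ‖)
  have h2 := sum_norm_coordProj_sq_le T hT ξ
  rw [Finset.card_univ, Fintype.card_fin] at h1
  refine abs_le_of_sq_le_sq' ?_ (by positivity) |>.2
  rw [mul_pow, Real.sq_sqrt (by positivity), mul_assoc]
  exact h1.trans (by gcongr)

/-- An operator that maps vectors vanishing on `T` to vectors supported in `T` has small matrix
coefficients at vectors that are almost supported off `T`. -/
theorem norm_inner_le_of_vanishing {T : Set ι} {x : lp E 2 →L[ℂ] lp E 2} {C : ℝ} (hC : ‖x‖ ≤ C)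
    (hx : ∀ ξ : lp E 2, (∀ i ∈ T, ξ i = 0) → ∀ i ∉ T, x ξ i = 0) (ξ η : lp E 2) :
    ‖inner ℂ η (x ξ)‖ ≤ C * ‖ξ‖ * ‖coordProj T η‖ + C * ‖coordProj T ξ‖ * ‖η‖ := by
  have hC0 : 0 ≤ C := x.opNorm_nonneg.trans hC
  have h1 : inner ℂ η (x (coordProj Tᶜ ξ)) = inner ℂ (coordProj T η) (x (coordProj Tᶜ ξ)) := by
    rw [lp.inner_eq_tsum, lp.inner_eq_tsum]
    refine tsum_congr fun i => ?_
    by_cases hi : i ∈ T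
    · rw [coordProj_apply_of_mem hi]
    · rw [hx _ (fun k hk => coordProj_apply_of_notMem (by simpa using hk) _) i hi,
        inner_zero_right, inner_zero_right]
  have h2 : ‖coordProj Tᶜ ξ‖ ≤ ‖ξ‖ := by
    refine abs_le_of_sq_le_sq' (hasSum_le (fun i => ?_) (lp_hasSum_norm_sq _)
      (lp_hasSum_norm_sq ξ)) (norm_nonneg _) |>.2
    rw [coordProj_apply]
    split_ifs
    · exact le_rfl
    · rw [norm_zero, zero_pow two_ne_zero]; positivity
  have h3 : ∀ ζ, ‖x ζ‖ ≤ C * ‖ζ‖ := fun ζ => x.le_of_opNorm_le hC ζ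
  calc ‖inner ℂ η (x ξ)‖
      = ‖inner ℂ (coordProj T η) (x (coordProj Tᶜ ξ)) + inner ℂ η (x (coordProj T ξ))‖ := by
        rw [← h1, ← inner_add_right, ← map_add, add_comm, coordProj_add_compl]
    _ ≤ ‖coordProj T η‖ * ‖x (coordProj Tᶜ ξ)‖ + ‖η‖ * ‖x (coordProj T ξ)‖ :=
        (norm_add_le _ _).trans (add_le_add (norm_inner_le_norm _ _) (norm_inner_le_norm _ _))
    _ ≤ ‖coordProj T η‖ * (C * ‖ξ‖) + ‖η‖ * (C * ‖coordProj T ξ‖) := by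
        gcongr
        · exact (h3 _).trans (by gcongr)
        · exact h3 _
    _ = _ := by ring

/-- A sum of `N` operators of norm at most `C`, the `j`-th of which maps vectors vanishing on `T_j`
to vectors supported in `T_j`, has norm of order `√N` if the multiplicity of the covering by the
sets `T_j` is bounded. -/
theorem norm_sum_le_of_vanishing {N n : ℕ} (T : Fin N → Set ι)
    (hT : ∀ i, Set.ncard {j | i ∈ T j} ≤ n) {x : Fin N → (lp E 2 →L[ℂ] lp E 2)} {C : ℝ}
    (hC0 : 0 ≤ C) (hC : ∀ j, ‖x j‖ ≤ C)
    (hx : ∀ j, ∀ ξ : lp E 2, (∀ i ∈ T j, ξ i = 0) → ∀ i ∉ T j, x j ξ i = 0) :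
    ‖∑ j, x j‖ ≤ 2 * C * √(N * n) := by
  refine ContinuousLinearMap.opNorm_le_bound _ (by positivity) fun ξ => ?_
  set η := (∑ j, x j) ξ with hη
  have h1 : ‖η‖ * ‖η‖ ≤ 2 * C * √(N * n) * ‖ξ‖ * ‖η‖ := by
    calc ‖η‖ * ‖η‖ = ‖inner ℂ η η‖ := by
          rw [inner_self_eq_norm_sq_to_K]; simp [sq]
      _ = ‖∑ j, inner ℂ η (x j ξ)‖ := by
          rw [← inner_sum, ← sum_apply]
      _ ≤ ∑ j, (C * ‖ξ‖ * ‖coordProj (T j) η‖ + C * ‖coordProj (T j) ξ‖ * ‖η‖) :=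
          (norm_sum_le _ _).trans
            (Finset.sum_le_sum fun j _ => norm_inner_le_of_vanishing (hC j) (hx j) ξ η)
      _ = C * ‖ξ‖ * ∑ j, ‖coordProj (T j) η‖ + C * ‖η‖ * ∑ j, ‖coordProj (T j) ξ‖ := by
          rw [Finset.mul_sum, Finset.mul_sum, ← Finset.sum_add_distrib]
          exact Finset.sum_congr rfl fun j _ => by ring
      _ ≤ C * ‖ξ‖ * (√(N * n) * ‖η‖) + C * ‖η‖ * (√(N * n) * ‖ξ‖) := by
          gcongr <;> exact sum_norm_coordProj_le T hT _
      _ = _ := by ring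
  rcases (norm_nonneg η).eq_or_lt with h2 | h2
  · rw [← h2]; positivity
  · exact le_of_mul_le_mul_right h1 h2

end CoordinateProjections

namespace TwistedAction

variable {A G : Type*} [CStarAlgebra A] [Group G] (S : TwistedAction A G)

/-! ### Supports of elements of the crossed product -/

theorem norm_toOperator (x : S.CrossedProduct) : ‖S.toOperator x‖ = ‖x‖ := rfl

theorem toOperator_injective : Function.Injective S.toOperator := Subtype.val_injective

theorem toOperator_incl (a : A) : S.toOperator (S.incl a) = S.regRep a := rfl

theorem toOperator_shift (g : G) : S.toOperator (S.shift g) = S.regShift g := rfl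

/-- An element `x` of the crossed product is supported in `F ⊆ G` if the coordinate of `x ξ` at `h`
depends only on the coordinates of `ξ` in `F⁻¹ h`. For a finite sum `∑ a_g λ(g)` this holds as soon
as `a_g = 0` for all `g ∉ F`. -/
def IsSupportedIn (F : Set G) (x : S.CrossedProduct) : Prop :=
  ∀ (ξ : S.Space) (h : G), (∀ g ∈ F, ξ (g⁻¹ * h) = 0) → S.toOperator x ξ h = 0

variable {S}

theorem IsSupportedIn.mono {F F' : Set G} {x : S.CrossedProduct} (hx : S.IsSupportedIn F x)
    (h : F ⊆ F') : S.IsSupportedIn F' x := fun ξ k hξ => hx ξ k fun g hg => hξ g (h hg)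

theorem IsSupportedIn.mul {F F' K : Set G} {x y : S.CrossedProduct} (hx : S.IsSupportedIn F x)
    (hy : S.IsSupportedIn F' y) (hK : ∀ g ∈ F, ∀ g' ∈ F', g * g' ∈ K) :
    S.IsSupportedIn K (x * y) := fun ξ h hξ => by
  rw [map_mul]
  refine hx _ h fun g hg => hy _ _ fun g' hg' => ?_
  have := hξ _ (hK g hg g' hg')
  rwa [mul_inv_rev, mul_assoc] at this

theorem IsSupportedIn.zero {F : Set G} : S.IsSupportedIn F 0 := fun ξ h _ => by
  rw [map_zero]; rfl

theorem IsSupportedIn.add {F : Set G} {x y : S.CrossedProduct} (hx : S.IsSupportedIn F x)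
    (hy : S.IsSupportedIn F y) : S.IsSupportedIn F (x + y) := fun ξ h hξ => by
  rw [map_add, add_apply, lp.coeFn_add, Pi.add_apply, hx ξ h hξ, hy ξ h hξ,
    add_zero]

theorem IsSupportedIn.smul {F : Set G} {x : S.CrossedProduct} (hx : S.IsSupportedIn F x) (c : ℂ) :
    S.IsSupportedIn F (c • x) := fun ξ h hξ => by
  rw [map_smul, smul_apply, lp.coeFn_smul, Pi.smul_apply, hx ξ h hξ, smul_zero]

theorem IsSupportedIn.sum {ι : Type*} {F : Set G} {s : Finset ι} {x : ι → S.CrossedProduct}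
    (hx : ∀ i ∈ s, S.IsSupportedIn F (x i)) : S.IsSupportedIn F (∑ i ∈ s, x i) :=
  Finset.sum_induction _ _ (fun _ _ => IsSupportedIn.add) IsSupportedIn.zero hx

variable (S)

theorem isSupportedIn_incl (a : A) : S.IsSupportedIn {1} (S.incl a) := fun ξ h hξ => by
  have := hξ 1 rfl
  rw [inv_one, one_mul] at this
  rw [toOperator_incl, regRep_apply, this, map_zero]

theorem isSupportedIn_shift (g : G) : S.IsSupportedIn {g} (S.shift g) := fun ξ h hξ => by
  rw [toOperator_shift, regShift_apply, hξ g rfl, map_zero]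

theorem shift_mul_star (g : G) : S.shift g * star (S.shift g) = 1 :=
  Subtype.ext (S.regShift_mul_star g)

theorem star_shift_mul (g : G) : star (S.shift g) * S.shift g = 1 :=
  Subtype.ext (S.star_regShift_mul g)

theorem shift_mul_incl (g : G) (a : A) : S.shift g * S.incl a = S.incl (S.act g a) * S.shift g :=
  Subtype.ext (S.regShift_mul_regRep g a)

theorem shift_one : S.shift 1 = 1 := Subtype.ext S.regShift_one

theorem shift_mem_unitary (g : G) : S.shift g ∈ unitary S.CrossedProduct :=
  Unitary.mem_iff.2 ⟨S.star_shift_mul g, S.shift_mul_star g⟩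

theorem star_shift (g : G) : star (S.shift g) =
    S.incl (S.act g⁻¹ (star (S.cocycle g g⁻¹ : A))) * S.shift g⁻¹ :=
  Subtype.ext (S.star_regShift g)

theorem isSupportedIn_star_shift (g : G) : S.IsSupportedIn {g⁻¹} (star (S.shift g)) := by
  rw [star_shift]
  exact (S.isSupportedIn_incl _).mul (S.isSupportedIn_shift _) (by simp)

theorem isSupportedIn_incl_mul_shift (a : A) (g : G) :
    S.IsSupportedIn {g} (S.incl a * S.shift g) :=
  (S.isSupportedIn_incl _).mul (S.isSupportedIn_shift _) (by simp)

/-- Conjugation of an element supported in `F` by `λ(h)` moves the support to `h F h⁻¹`. -/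
theorem IsSupportedIn.conj {S : TwistedAction A G} {F : Set G} {x : S.CrossedProduct}
    (hx : S.IsSupportedIn F x) (h : G) :
    S.IsSupportedIn ((fun f => h * f * h⁻¹) '' F) (S.shift h * x * star (S.shift h)) :=
  IsSupportedIn.mul (F := (fun f => h * f) '' F)
    ((S.isSupportedIn_shift h).mul hx (by rintro _ rfl f hf; exact ⟨f, hf, rfl⟩))
    (S.isSupportedIn_star_shift h) (by rintro _ ⟨f, hf, rfl⟩ _ rfl; exact ⟨f, hf, rfl⟩)

/-- Every element of the crossed product is a limit of finite sums `∑ a_g λ(g)`. -/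
theorem exists_finite_sum_near (x : S.CrossedProduct) {ε : ℝ} (hε : 0 < ε) :
    ∃ y ∈ Submodule.span ℂ (Set.range fun p : A × G => S.incl p.1 * S.shift p.2),
      ‖x - y‖ < ε := by
  have h1 := S.crossedSubalgebra_le x.2
  obtain ⟨y, hy, hxy⟩ := Metric.mem_closure_iff.1 h1 ε hε
  have h2 : S.finiteSums = (Submodule.span ℂ
      (Set.range fun p : A × G => S.incl p.1 * S.shift p.2)).map S.toOperator.toLinearMap := by
    rw [Submodule.map_span, ← Set.range_comp]
    rfl
  have hy' : y ∈ S.finiteSums := hy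
  rw [h2] at hy'
  obtain ⟨z, hz, rfl⟩ := hy'
  refine ⟨z, hz, ?_⟩
  rwa [dist_eq_norm] at hxy

/-- A closed condition on elements of the crossed product that is stable under linear combinations
holds everywhere if it holds for all `a λ(g)`. -/
theorem crossedProduct_induction {P : S.CrossedProduct → Prop} (hclosed : IsClosed {x | P x})
    (hadd : ∀ x y, P x → P y → P (x + y)) (hsmul : ∀ (c : ℂ) x, P x → P (c • x))
    (h : ∀ a g, P (S.incl a * S.shift g)) (x : S.CrossedProduct) : P x := by
  refine hclosed.closure_subset (Metric.mem_closure_iff.2 fun ε hε => ?_)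
  obtain ⟨y, hy, hxy⟩ := S.exists_finite_sum_near x hε
  refine ⟨y, ?_, by rwa [dist_eq_norm]⟩
  clear hxy
  induction hy using Submodule.span_induction with
  | mem y hy =>
    obtain ⟨⟨a, g⟩, rfl⟩ := hy
    exact h a g
  | zero => simpa using hsmul 0 _ (h 0 1)
  | add y z _ _ hy hz => exact hadd y z hy hz
  | smul c y _ hy => exact hsmul c y hy

end TwistedAction

theorem starAlgHom_continuous {A B : Type*} [CStarAlgebra A] [CStarAlgebra B]
    (φ : A →⋆ₐ[ℂ] B) : Continuous φ :=
  AddMonoidHomClass.continuous_of_bound φ 1 fun a => by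
    rw [one_mul]
    exact NonUnitalStarAlgHom.norm_apply_le φ a

section Corner

variable {ι : Type*} {E : ι → Type*} [∀ i, NormedAddCommGroup (E i)]
  [∀ i, InnerProductSpace ℂ (E i)] [∀ i, CompleteSpace (E i)] [DecidableEq ι]

theorem inner_star_mul_single (T : lp E 2 →L[ℂ] lp E 2) (i : ι) (v : E i) :
    inner ℂ v ((star T * T) (lp.single 2 i v) i) = (‖T (lp.single 2 i v)‖ ^ 2 : ℝ) := by
  rw [← lp.inner_single_left, ContinuousLinearMap.star_eq_adjoint, mul_apply_eq_comp,
    ContinuousLinearMap.adjoint_inner_right, inner_self_eq_norm_sq_to_K]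
  norm_cast

/-- The diagonal corners of a positive operator on a Hilbert space direct sum are positive. -/
theorem isPositive_corner (T : lp E 2 →L[ℂ] lp E 2) (i : ι) :
    (lp.evalCLM ℂ E 2 i ∘L (star T * T) ∘L lp.singleContinuousLinearMap ℂ E 2 i).IsPositive := by
  rw [ContinuousLinearMap.isPositive_iff_complex]
  intro v
  change (RCLike.re (inner ℂ ((star T * T) (lp.single 2 i v) i) v) : ℂ)
    = inner ℂ ((star T * T) (lp.single 2 i v) i) v ∧
    0 ≤ RCLike.re (inner ℂ ((star T * T) (lp.single 2 i v) i) v)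
  rw [← inner_conj_symm, inner_star_mul_single, Complex.conj_ofReal]
  exact ⟨rfl, by simp only [RCLike.re_to_complex, Complex.ofReal_re]; positivity⟩

theorem apply_single_eq_zero_of_corner {T : lp E 2 →L[ℂ] lp E 2} {i : ι}
    (h : ∀ w, (star T * T) (lp.single 2 i w) i = 0) (v : E i) : T (lp.single 2 i v) = 0 := by
  have h1 := inner_star_mul_single T i v
  rw [h, inner_zero_right] at h1
  have h2 : ‖T (lp.single 2 i v)‖ ^ 2 = 0 := by exact_mod_cast h1.symm
  exact norm_eq_zero.1 (pow_eq_zero_iff two_ne_zero |>.1 h2)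

end Corner

namespace TwistedAction

variable {A G : Type*} [CStarAlgebra A] [Group G] (S : TwistedAction A G)

/-! ### The conditional expectation -/

theorem universalRep_condExp_apply [d : DecidableEq G] (x : S.CrossedProduct) (v : UniversalSpace A) :
    universalRep A (S.condExp x) v = S.toOperator x (lp.single 2 1 v) 1 := by
  rw [universalRep_condExp, Subsingleton.elim d (Classical.decEq G)]
  rfl

theorem norm_condExp_le (x : S.CrossedProduct) : ‖S.condExp x‖ ≤ ‖x‖ := by
  classical
  rw [← NonUnitalStarAlgHom.norm_map (universalRep A) universalRep_injective]
  refine ContinuousLinearMap.opNorm_le_bound _ (norm_nonneg _) fun v => ?_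
  rw [universalRep_condExp_apply]
  refine (lp.norm_apply_le_norm two_ne_zero _ _).trans (((S.toOperator x).le_opNorm _).trans ?_)
  refine (congrArg (‖S.toOperator x‖ * ·) ?_).le
  exact lp.norm_single (E := fun _ : G => UniversalSpace A) (by norm_num) 1 v

theorem continuous_condExp : Continuous S.condExp :=
  AddMonoidHomClass.continuous_of_bound S.condExp 1 fun x => by
    rw [one_mul]
    exact S.norm_condExp_le x

theorem condExp_eq_zero_of_isSupportedIn {F : Set G} {x : S.CrossedProduct}
    (hx : S.IsSupportedIn F x) (hF : 1 ∉ F) : S.condExp x = 0 := by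
  classical
  apply universalRep_injective
  ext1 v
  rw [universalRep_condExp_apply, map_zero]
  refine hx _ _ fun g hg => lp.single_apply_ne _ _ _ ?_
  rw [mul_one, ne_eq, inv_eq_one]
  rintro rfl
  exact hF hg

theorem condExp_incl (a : A) : S.condExp (S.incl a) = a := by
  classical
  simpa [shift_one] using S.condExp_incl_mul_shift a 1

theorem condExp_one : S.condExp 1 = 1 := by
  simpa using S.condExp_incl 1

theorem condExp_incl_mul (a : A) (x : S.CrossedProduct) :
    S.condExp (S.incl a * x) = a * S.condExp x := by
  classical
  induction x using S.crossedProduct_induction with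
  | hclosed =>
    exact isClosed_eq (S.continuous_condExp.comp (continuous_const_mul _))
      ((continuous_const_mul _).comp S.continuous_condExp)
  | hadd x y hx hy => rw [mul_add, map_add, map_add, hx, hy, mul_add]
  | hsmul c x hx => rw [mul_smul_comm, map_smul, map_smul, hx, mul_smul_comm]
  | h b g =>
    rw [← mul_assoc, ← map_mul, condExp_incl_mul_shift, condExp_incl_mul_shift, mul_ite, mul_zero]

theorem condExp_mul_incl (a : A) (x : S.CrossedProduct) :
    S.condExp (x * S.incl a) = S.condExp x * a := by
  classical
  induction x using S.crossedProduct_induction with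
  | hclosed =>
    exact isClosed_eq (S.continuous_condExp.comp (continuous_mul_const _))
      ((continuous_mul_const _).comp S.continuous_condExp)
  | hadd x y hx hy => rw [add_mul, map_add, map_add, hx, hy, add_mul]
  | hsmul c x hx => rw [smul_mul_assoc, map_smul, map_smul, hx, smul_mul_assoc]
  | h b g =>
    rw [mul_assoc, shift_mul_incl, ← mul_assoc, ← map_mul, condExp_incl_mul_shift,
      condExp_incl_mul_shift]
    split_ifs with h
    · rw [h, act_one]
    · rw [zero_mul]

/-- The conditional expectation is equivariant for conjugation by the unitaries `λ(h)`. -/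
theorem condExp_conj (h : G) (x : S.CrossedProduct) :
    S.condExp (S.shift h * x * star (S.shift h)) = S.act h (S.condExp x) := by
  classical
  induction x using S.crossedProduct_induction with
  | hclosed =>
    exact isClosed_eq
      (S.continuous_condExp.comp ((continuous_mul_const _).comp (continuous_const_mul _)))
      ((NonUnitalStarAlgHom.isometry (S.act h) (EquivLike.injective _)).continuous.comp
        S.continuous_condExp)
  | hadd x y hx hy => rw [mul_add, add_mul, map_add, map_add, map_add, hx, hy]
  | hsmul c x hx => rw [mul_smul_comm, smul_mul_assoc, map_smul, map_smul, map_smul, hx]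
  | h b g =>
    rw [condExp_incl_mul_shift]
    split_ifs with hg
    · rw [hg, shift_one, mul_one, shift_mul_incl, mul_assoc, shift_mul_star, mul_one, condExp_incl]
    · rw [map_zero]
      refine S.condExp_eq_zero_of_isSupportedIn ((S.isSupportedIn_incl_mul_shift b g).conj h) ?_
      rintro ⟨f, rfl, hf⟩
      exact hg (by simpa [mul_inv_eq_one] using hf)

section Order

attribute [local instance] CStarAlgebra.spectralOrder CStarAlgebra.spectralOrderedRing

/-- The conditional expectation is positive. -/
theorem exists_condExp_star_mul_self (x : S.CrossedProduct) :
    ∃ b : A, S.condExp (star x * x) = star b * b := by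
  classical
  set a := S.condExp (star x * x) with ha
  have h1 : (universalRep A a).IsPositive := by
    rw [ha, universalRep_condExp, map_mul, map_star]
    exact isPositive_corner (S.toOperator x) (1 : G)
  have h2 : IsSelfAdjoint a := by
    apply universalRep_injective
    rw [map_star]
    exact h1.isSelfAdjoint
  have h3 : 0 ≤ a := by
    rw [StarOrderedRing.nonneg_iff_spectrum_nonneg (R := ℝ) a h2,
      ← h2.map_spectrum_real (universalRep A) universalRep_injective]
    exact SpectrumRestricts.nnreal_iff.1 h1.spectrumRestricts
  exact CStarAlgebra.nonneg_iff_eq_star_mul_self.1 h3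

end Order

/-- The conditional expectation is faithful; only elements `star y * y` for right translates `y`
of `x` need to be tested. -/
theorem eq_zero_of_condExp_star_mul_self {x : S.CrossedProduct}
    (h : ∀ g, S.condExp (star (x * S.shift g) * (x * S.shift g)) = 0) : x = 0 := by
  classical
  have h1 : ∀ g v, S.toOperator x (S.regShift g (lp.single 2 1 v)) = 0 := fun g v => by
    refine apply_single_eq_zero_of_corner (T := S.toOperator (x * S.shift g)) (fun w => ?_) v
    have h2 := S.universalRep_condExp_apply (star (x * S.shift g) * (x * S.shift g)) w
    rw [h g, map_zero, map_mul, map_star] at h2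
    exact h2.symm
  apply S.toOperator_injective
  rw [map_zero]
  refine lp.ext_continuousLinearMap (by norm_num) fun g => ?_
  ext1 v
  set u := S.cocycle g⁻¹ g with hu
  -- `λ(g)` maps `δ_1 ⊗ σ(g⁻¹, g)⋆ v` to `δ_g ⊗ v`
  have h5 : S.regShift g (lp.single 2 1 (universalRep A (star (u : A)) v)) = lp.single 2 g v := by
    refine lp.ext (funext fun k => ?_)
    rw [regShift_apply]
    by_cases hk : k = g
    · subst hk
      rw [inv_mul_cancel, lp.single_apply_self, lp.single_apply_self, ← hu,
        ← mul_apply_eq_comp, ← map_mul, Unitary.mul_star_self_of_mem u.2, map_one]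
      rfl
    · rw [lp.single_apply_ne _ _ _ hk, lp.single_apply_ne, map_zero]
      rwa [ne_eq, inv_mul_eq_one, eq_comm]
  change S.toOperator x (lp.single 2 g v) = 0
  rw [← h5, h1]

variable (J : ClosedIdeal A) (hJ : S.IsInvariant J)

theorem condExp_quotientHom (x : S.CrossedProduct) :
    (S.quotient J hJ).condExp (S.quotientHom J hJ x) = J.proj (S.condExp x) := by
  classical
  induction x using S.crossedProduct_induction with
  | hclosed =>
    exact isClosed_eq
      ((S.quotient J hJ).continuous_condExp.comp (starAlgHom_continuous (S.quotientHom J hJ)))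
      ((starAlgHom_continuous J.proj).comp S.continuous_condExp)
  | hadd x y hx hy => rw [map_add, map_add, map_add, map_add, hx, hy]
  | hsmul c x hx => rw [map_smul, map_smul, map_smul, map_smul, hx]
  | h b g =>
    rw [map_mul, quotientHom_incl, quotientHom_shift, condExp_incl_mul_shift,
      condExp_incl_mul_shift]
    split_ifs <;> simp

end TwistedAction

namespace TwistedAction

variable {A G : Type*} [CStarAlgebra A] [Group G] (S : TwistedAction A G)

/-! ### Averaging over conjugations by the canonical unitaries -/

/-- The average of the conjugates `λ(h_j) x λ(h_j)⋆` of `x`. -/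
def shiftAverage {N : ℕ} (h : Fin N → G) : S.CrossedProduct →ₗ[ℂ] S.CrossedProduct where
  toFun x := (N : ℂ)⁻¹ • ∑ j, S.shift (h j) * x * star (S.shift (h j))
  map_add' x y := by simp only [mul_add, add_mul, Finset.sum_add_distrib, smul_add]
  map_smul' c x := by
    simp only [mul_smul_comm, smul_mul_assoc, ← Finset.smul_sum, RingHom.id_apply]
    rw [smul_comm]

theorem shiftAverage_apply {N : ℕ} (h : Fin N → G) (x : S.CrossedProduct) :
    S.shiftAverage h x = (N : ℂ)⁻¹ • ∑ j, S.shift (h j) * x * star (S.shift (h j)) := rfl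

theorem norm_conj_shift (h : G) (x : S.CrossedProduct) :
    ‖S.shift h * x * star (S.shift h)‖ = ‖x‖ := by
  rw [CStarRing.norm_mul_mem_unitary _ (Unitary.star_mem (S.shift_mem_unitary h)),
    CStarRing.norm_mem_unitary_mul _ (S.shift_mem_unitary h)]

theorem norm_shiftAverage_le {N : ℕ} (h : Fin N → G) (x : S.CrossedProduct) :
    ‖S.shiftAverage h x‖ ≤ ‖x‖ := by
  rw [shiftAverage_apply, norm_smul, norm_inv, Complex.norm_natCast]
  have h1 : ‖∑ j, S.shift (h j) * x * star (S.shift (h j))‖ ≤ N * ‖x‖ :=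
    (norm_sum_le _ _).trans (by simp [norm_conj_shift])
  rcases Nat.eq_zero_or_pos N with rfl | hN
  · simp
  · rw [inv_mul_le_iff₀ (by exact_mod_cast hN)]
    exact h1

theorem IsSupportedIn.shiftAverage {S : TwistedAction A G} {F : Set G} {x : S.CrossedProduct}
    (hx : S.IsSupportedIn F x) {N : ℕ} (h : Fin N → G) :
    S.IsSupportedIn (⋃ j, (fun f => h j * f * (h j)⁻¹) '' F) (S.shiftAverage h x) :=
  (IsSupportedIn.sum fun j _ => (hx.conj (h j)).mono
    (Set.subset_iUnion (fun j => (fun f => h j * f * (h j)⁻¹) '' F) j)).smul _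

/-- The key estimate: conjugates of an element supported in `F` average out if the corresponding
conjugates of `F` admit large sets that overlap at most `n` times. -/
theorem norm_shiftAverage_le_of_isLarge {F : Set G} {x : S.CrossedProduct}
    (hx : S.IsSupportedIn F x) {N n : ℕ} (h : Fin N → G) (T : Fin N → Set G)
    (hT : ∀ i, Set.ncard {j | i ∈ T j} ≤ n)
    (hlarge : ∀ j, IsLarge ((fun f => h j * f * (h j)⁻¹) '' F) (T j)) :
    ‖S.shiftAverage h x‖ ≤ (N : ℝ)⁻¹ * (2 * ‖x‖ * √(N * n)) := by
  rw [shiftAverage_apply, norm_smul, norm_inv, Complex.norm_natCast]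
  gcongr
  rw [← norm_toOperator, map_sum]
  refine norm_sum_le_of_vanishing T hT (norm_nonneg x) (fun j => ?_) fun j ξ hξ i hi => ?_
  · exact (S.norm_conj_shift (h j) x).le
  · refine hx.conj (h j) ξ i fun m hm => hξ _ ?_
    by_contra hmi
    exact hi (by simpa using hlarge j m hm _ hmi)

theorem exists_nat_inv_mul_sqrt_lt (C : ℝ) (n : ℕ) {ε : ℝ} (hε : 0 < ε) :
    ∃ N : ℕ, 0 < N ∧ (N : ℝ)⁻¹ * (C * √(N * n)) < ε := by
  have h1 : Filter.Tendsto (fun N : ℕ => C * √n * (√(N : ℝ))⁻¹) Filter.atTop (nhds 0) := by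
    rw [← mul_zero (C * √n)]
    exact (tendsto_inv_atTop_zero.comp
      (Real.tendsto_sqrt_atTop.comp tendsto_natCast_atTop_atTop)).const_mul _
  obtain ⟨N, hN, hN0⟩ :=
    ((h1.eventually (gt_mem_nhds hε)).and (Filter.eventually_gt_atTop 0)).exists
  refine ⟨N, hN0, lt_of_eq_of_lt ?_ hN⟩
  have h2 : (0 : ℝ) < N := by exact_mod_cast hN0
  have h3 : (N : ℝ) = √N * √N := (Real.mul_self_sqrt h2.le).symm
  have h4 : 0 < √(N : ℝ) := Real.sqrt_pos.2 h2
  rw [Real.sqrt_mul h2.le]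
  nth_rewrite 1 [h3]
  field_simp

theorem exists_norm_shiftAverage_lt_of_isPowersSet {F H : Set G} (hF : IsPowersSet F H)
    {x : S.CrossedProduct} (hx : S.IsSupportedIn F x) {ε : ℝ} (hε : 0 < ε) :
    ∃ (N : ℕ) (h : Fin N → G), 0 < N ∧ (∀ j, h j ∈ H) ∧ ‖S.shiftAverage h x‖ < ε := by
  obtain ⟨N, hN, hlt⟩ := exists_nat_inv_mul_sqrt_lt (2 * ‖x‖) 1 hε
  obtain ⟨h, T, hh, hdisj, hlarge⟩ := hF N
  refine ⟨N, h, hN, hh,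
    (S.norm_shiftAverage_le_of_isLarge hx h T (fun i => ?_) hlarge).trans_lt hlt⟩
  rw [Set.ncard_le_one]
  intro j hj k hk
  by_contra hne
  exact Set.disjoint_left.1 (hdisj j k hne) hj hk

theorem exists_norm_shiftAverage_lt_of_hasPropertyPcom (hG : HasPropertyPcom G) {F : Finset G}
    (hF : F.Nonempty) (hF1 : 1 ∉ F) {x : S.CrossedProduct} (hx : S.IsSupportedIn F x) {ε : ℝ}
    (hε : 0 < ε) : ∃ (N : ℕ) (h : Fin N → G), 0 < N ∧ ‖S.shiftAverage h x‖ < ε := by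
  obtain ⟨n, g, U, D, hUD, hFU, hD⟩ := hG F hF hF1
  obtain ⟨N, hN, hlt⟩ := exists_nat_inv_mul_sqrt_lt (2 * ‖x‖) n hε
  -- the translates `g ^ j (G ∖ U)` overlap at most `n` times since those of each `D k` are disjoint
  refine ⟨N, fun j => g ^ (j : ℕ), hN, (S.norm_shiftAverage_le_of_isLarge hx _
    (fun j => {i | (g ^ (j : ℕ))⁻¹ * i ∉ U}) (fun i => ?_) fun j => ?_).trans_lt hlt⟩
  · have h1 : ∀ j : Fin N, (g ^ (j : ℕ))⁻¹ * i ∉ U → ∃ k, (g ^ (j : ℕ))⁻¹ * i ∈ D k :=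
      fun j hj => by simpa using hUD hj
    choose k hk using h1
    have hlt : ∀ (j j' : Fin N) (hj : (g ^ (j : ℕ))⁻¹ * i ∉ U) (hj' : (g ^ (j' : ℕ))⁻¹ * i ∉ U),
        k j hj = k j' hj' → ¬ j < j' := fun j j' hj hj' hkk hjj => by
      have h2 : (g ^ (j' : ℕ))⁻¹ * i ∈ (fun x => (g ^ (j' - j : ℕ))⁻¹ * x) '' D (k j hj) := by
        refine ⟨(g ^ (j : ℕ))⁻¹ * i, hk j hj, ?_⟩
        change (g ^ (j' - j : ℕ))⁻¹ * ((g ^ (j : ℕ))⁻¹ * i) = _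
        rw [← mul_assoc, ← mul_inv_rev, ← pow_add, Nat.add_sub_cancel' (Fin.lt_def.1 hjj).le]
      refine Set.disjoint_left.1 (hD _ (Nat.sub_pos_of_lt (Fin.lt_def.1 hjj)) (k j hj)) h2 ?_
      rw [hkk]
      exact hk j' hj'
    rw [← Nat.card_coe_set_eq]
    refine (Nat.card_le_card_of_injective
      (fun j : {j : Fin N | (g ^ (j : ℕ))⁻¹ * i ∉ U} => k j j.2) fun j j' hkk => ?_).trans
      (Nat.card_fin n).le
    exact Subtype.ext (le_antisymm (not_lt.1 (hlt _ _ j'.2 j.2 hkk.symm))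
      (not_lt.1 (hlt _ _ j.2 j'.2 hkk)))
  · rintro _ ⟨f, hf, rfl⟩ i hi
    simp only [Set.mem_ofPred_eq, not_not] at hi ⊢
    refine fun h2 => Set.disjoint_left.1 (hFU f hf) ⟨_, hi, ?_⟩ h2
    group

/-- Compositions of averages over conjugations by unitaries `λ(h)` with `h ∈ H`. -/
inductive IsIteratedAverage (H : Set G) : (S.CrossedProduct →ₗ[ℂ] S.CrossedProduct) → Prop
  | id : IsIteratedAverage H LinearMap.id
  | comp {N : ℕ} (hN : 0 < N) (h : Fin N → G) (hh : ∀ j, h j ∈ H)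
      {ψ : S.CrossedProduct →ₗ[ℂ] S.CrossedProduct} (hψ : IsIteratedAverage H ψ) :
      IsIteratedAverage H (S.shiftAverage h ∘ₗ ψ)

namespace IsIteratedAverage

variable {S} {H : Set G} {ψ : S.CrossedProduct →ₗ[ℂ] S.CrossedProduct}

theorem mono {H' : Set G} (hψ : S.IsIteratedAverage H ψ) (h : H ⊆ H') :
    S.IsIteratedAverage H' ψ := by
  induction hψ with
  | id => exact .id
  | comp hN k hk _ ih => exact .comp hN k (fun j => h (hk j)) ih

theorem norm_apply_le (hψ : S.IsIteratedAverage H ψ) (x : S.CrossedProduct) : ‖ψ x‖ ≤ ‖x‖ := by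
  induction hψ with
  | id => exact le_rfl
  | comp hN h hh _ ih => exact (S.norm_shiftAverage_le h _).trans ih

theorem map_one (hψ : S.IsIteratedAverage H ψ) : ψ 1 = 1 := by
  induction hψ with
  | id => rfl
  | @comp N hN h hh ψ _ ih =>
    have hN' : (N : ℂ) ≠ 0 := by exact_mod_cast hN.ne'
    rw [LinearMap.comp_apply, ih, shiftAverage_apply]
    simp only [mul_one, shift_mul_star, Finset.sum_const, Finset.card_univ, Fintype.card_fin]
    rw [← Nat.cast_smul_eq_nsmul ℂ, smul_smul, inv_mul_cancel₀ hN', one_smul]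

theorem apply_mem (hψ : S.IsIteratedAverage H ψ) (K : ClosedIdeal S.CrossedProduct)
    {x : S.CrossedProduct} (hx : x ∈ K) : ψ x ∈ K := by
  induction hψ with
  | id => exact hx
  | @comp N hN h hh ψ _ ih =>
    rw [LinearMap.comp_apply, shiftAverage_apply, ← one_mul (∑ j, _), ← smul_mul_assoc]
    refine K.ideal.mul_mem_left _ _ (sum_mem (S := K.ideal) fun j _ => ?_)
    exact K.ideal.mul_mem_right _ _ (K.ideal.mul_mem_left _ _ ih)

theorem map_eq_of_isTracialState (hψ : S.IsIteratedAverage H ψ) {τ : S.CrossedProduct →ₗ[ℂ] ℂ}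
    (hτ : IsTracialState τ) (x : S.CrossedProduct) : τ (ψ x) = τ x := by
  induction hψ with
  | id => rfl
  | @comp N hN h hh ψ _ ih =>
    have hN' : (N : ℂ) ≠ 0 := by exact_mod_cast hN.ne'
    have h1 : ∀ j, τ (S.shift (h j) * ψ x * star (S.shift (h j))) = τ x := fun j => by
      rw [hτ.tracial, ← mul_assoc, star_shift_mul, one_mul, ih]
    rw [LinearMap.comp_apply, shiftAverage_apply, map_smul, map_sum]
    simp only [h1, Finset.sum_const, Finset.card_univ, Fintype.card_fin, nsmul_eq_mul, smul_eq_mul]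
    rw [inv_mul_cancel_left₀ hN']

/-- Iterated averages over a subgroup `K` spread a one-point support `{f}` over finitely many
conjugates of `f` by elements of `K`. -/
theorem exists_isSupportedIn {K : Subgroup G} (hψ : S.IsIteratedAverage K ψ) {f : G}
    {x : S.CrossedProduct} (hx : S.IsSupportedIn {f} x) :
    ∃ M : Set G, M.Finite ∧ M.Nonempty ∧ M ⊆ K ∧
      S.IsSupportedIn ((fun a => a * f * a⁻¹) '' M) (ψ x) := by
  induction hψ with
  | id => exact ⟨{1}, Set.finite_singleton 1, Set.singleton_nonempty 1, by simp, by simpa using hx⟩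
  | @comp N hN h hh ψ _ ih =>
    obtain ⟨M, hM, ⟨m, hm⟩, hMK, hsupp⟩ := ih
    refine ⟨⋃ j, (fun a => h j * a) '' M, Set.finite_iUnion fun j => hM.image _,
      ⟨h ⟨0, hN⟩ * m, Set.mem_iUnion.2 ⟨_, m, hm, rfl⟩⟩,
      Set.iUnion_subset fun j => Set.image_subset_iff.2 fun a ha =>
        K.mul_mem (hh j) (hMK ha), (hsupp.shiftAverage h).mono ?_⟩
    refine Set.iUnion_subset fun j => ?_
    rintro _ ⟨_, ⟨a, ha, rfl⟩, rfl⟩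
    refine ⟨h j * a, Set.mem_iUnion.2 ⟨j, a, ha, rfl⟩, ?_⟩
    simp [mul_assoc]

end IsIteratedAverage

/-- Along a chain of subgroups `K_1 ⊆ K_2 ⊆ …` such that `K_j` is a c-Powers set for `f_j`, the
terms with supports `{f_j}` can be made small one after the other: the averages that deal with the
first `m` terms are taken over subgroups contained in the next one. -/
theorem exists_isIteratedAverage_of_chain {n : ℕ} {f : Fin n → G} {K : Fin n → Subgroup G}
    (hK : Monotone K) (hf : ∀ j, IsCPowersSet (f j) (K j : Set G)) {x : Fin n → S.CrossedProduct}
    (hx : ∀ j, S.IsSupportedIn {f j} (x j)) {ε : ℝ} (hε : 0 < ε) {m : ℕ} (hm : m ≤ n) :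
    ∃ ψ, S.IsIteratedAverage {g | ∃ j : Fin n, (j : ℕ) < m ∧ g ∈ K j} ψ ∧
      ∀ j : Fin n, (j : ℕ) < m → ‖ψ (x j)‖ < ε := by
  induction m with
  | zero => exact ⟨_, .id, fun j hj => absurd hj (Nat.not_lt_zero _)⟩
  | succ m ih =>
    obtain ⟨ψ, hψ, hlt⟩ := ih (Nat.le_of_succ_le hm)
    set i : Fin n := ⟨m, hm⟩ with hi
    have h1 : S.IsIteratedAverage (K i) ψ := hψ.mono fun g ⟨j, hj, hg⟩ =>
      hK (Fin.le_def.2 hj.le) hg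
    obtain ⟨M, hM, hM0, hMK, hsupp⟩ := h1.exists_isSupportedIn (hx i)
    obtain ⟨N, h, hN, hh, hsmall⟩ :=
      S.exists_norm_shiftAverage_lt_of_isPowersSet (hf i M hM hM0 hMK) hsupp hε
    have h2 : S.IsIteratedAverage {g | ∃ j : Fin n, (j : ℕ) < m + 1 ∧ g ∈ K j} ψ :=
      hψ.mono fun g ⟨j, hj, hg⟩ => ⟨j, hj.trans (Nat.lt_succ_self m), hg⟩
    have h3 : ∀ j, h j ∈ {g | ∃ j : Fin n, (j : ℕ) < m + 1 ∧ g ∈ K j} := fun j =>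
      ⟨i, Nat.lt_succ_self m, hh j⟩
    refine ⟨S.shiftAverage h ∘ₗ ψ, .comp hN h h3 h2, fun j hj => ?_⟩
    rcases (Nat.lt_succ_iff.1 hj).lt_or_eq with hj | hj
    · exact (S.norm_shiftAverage_le h _).trans_lt (hlt j hj)
    · have hji : j = i := Fin.ext hj
      rw [hji]
      exact hsmall

theorem exists_isIteratedAverage_finset_sum (hG : IsClassP G) {F : Finset G} (hF1 : 1 ∉ F)
    {x : G → S.CrossedProduct} (hx : ∀ g, S.IsSupportedIn {g} (x g)) {ε : ℝ} (hε : 0 < ε) :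
    ∃ ψ, S.IsIteratedAverage Set.univ ψ ∧ ‖ψ (∑ g ∈ F, x g)‖ < ε := by
  classical
  rcases F.eq_empty_or_nonempty with rfl | hF
  · exact ⟨_, .id, by simpa using hε⟩
  rcases hG with hG | hG
  · obtain ⟨n, f, K, hfinj, hfF, hK, hf⟩ := hG F hF hF1
    have hn : (0 : ℝ) < n + 1 := by positivity
    obtain ⟨ψ, hψ, hlt⟩ := S.exists_isIteratedAverage_of_chain hK hf (fun j => hx (f j))
      (div_pos hε hn) le_rfl
    refine ⟨ψ, hψ.mono (Set.subset_univ _), ?_⟩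
    have hFf : F = Finset.univ.image f := by
      apply Finset.coe_injective
      rw [← hfF]
      simp
    rw [hFf, Finset.sum_image hfinj.injOn, map_sum]
    calc ‖∑ j, ψ (x (f j))‖ ≤ ∑ _j : Fin n, ε / (n + 1) :=
          (norm_sum_le _ _).trans (Finset.sum_le_sum fun j _ => (hlt j j.2).le)
      _ = ε * (n / (n + 1)) := by simp; ring
      _ < ε * 1 := by
          gcongr
          rw [div_lt_one hn]
          exact lt_add_one _
      _ = ε := mul_one ε
  · have hsupp : S.IsSupportedIn F (∑ g ∈ F, x g) :=
      IsSupportedIn.sum fun g hg => (hx g).mono (by simpa using hg)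
    obtain ⟨N, h, hN, hlt⟩ :=
      S.exists_norm_shiftAverage_lt_of_hasPropertyPcom hG hF hF1 hsupp hε
    exact ⟨_, .comp hN h (fun _ => Set.mem_univ _) .id, hlt⟩

theorem exists_finsupp_of_mem_span {y : S.CrossedProduct}
    (hy : y ∈ Submodule.span ℂ (Set.range fun p : A × G => S.incl p.1 * S.shift p.2)) :
    ∃ f : G →₀ A, y = f.sum fun g a => S.incl a * S.shift g := by
  induction hy using Submodule.span_induction with
  | mem y hy =>
    obtain ⟨⟨a, g⟩, rfl⟩ := hy
    exact ⟨Finsupp.single g a, by rw [Finsupp.sum_single_index]; simp⟩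
  | zero => exact ⟨0, by simp⟩
  | add y z _ _ hy hz =>
    obtain ⟨f, rfl⟩ := hy
    obtain ⟨f', rfl⟩ := hz
    refine ⟨f + f', ?_⟩
    rw [Finsupp.sum_add_index' (by simp) (by simp [add_mul])]
  | smul c y _ hy =>
    obtain ⟨f, rfl⟩ := hy
    refine ⟨c • f, ?_⟩
    rw [Finsupp.sum_smul_index' (by simp), Finsupp.smul_sum]
    simp

/-- For `G` in the class `𝒫`, every element with vanishing conditional expectation is averaged to
elements of arbitrarily small norm. -/
theorem exists_isIteratedAverage_norm_lt (hG : IsClassP G) {x : S.CrossedProduct}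
    (hx : S.condExp x = 0) {ε : ℝ} (hε : 0 < ε) :
    ∃ ψ, S.IsIteratedAverage Set.univ ψ ∧ ‖ψ x‖ < ε := by
  classical
  obtain ⟨y, hy, hxy⟩ := S.exists_finite_sum_near x (ε := ε / 3) (by positivity)
  obtain ⟨f, rfl⟩ := S.exists_finsupp_of_mem_span hy
  set y := f.sum fun g a => S.incl a * S.shift g with hydef
  set z := ∑ g ∈ f.support.erase 1, S.incl (f g) * S.shift g with hz
  obtain ⟨ψ, hψ, hlt⟩ := S.exists_isIteratedAverage_finset_sum hG (F := f.support.erase 1)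
    (by simp) (fun g => S.isSupportedIn_incl_mul_shift (f g) g) (ε := ε / 3) (by positivity)
  refine ⟨ψ, hψ, ?_⟩
  have h1 : y = S.incl (f 1) + z := by
    rw [hydef, hz, Finsupp.sum]
    by_cases h1 : (1 : G) ∈ f.support
    · rw [← Finset.add_sum_erase _ _ h1, shift_one, mul_one]
    · rw [Finset.erase_eq_of_notMem h1, Finsupp.notMem_support_iff.1 h1, map_zero, zero_add]
  have h2 : S.condExp z = 0 := by
    rw [hz, map_sum]
    refine Finset.sum_eq_zero fun g hg => ?_
    rw [condExp_incl_mul_shift, if_neg (Finset.ne_of_mem_erase hg)]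
  have h3 : S.condExp (x - y) = -f 1 := by
    rw [map_sub, hx, h1, map_add, h2, condExp_incl, add_zero, zero_sub]
  have h4 : ‖S.incl (f 1)‖ < ε / 3 := by
    refine (NonUnitalStarAlgHom.norm_apply_le S.incl _).trans_lt ?_
    rw [← norm_neg, ← h3]
    exact (S.norm_condExp_le _).trans_lt hxy
  have h5 : x = (x - y) + S.incl (f 1) + z := by
    rw [add_assoc, ← h1, sub_add_cancel]
  calc ‖ψ x‖ ≤ ‖ψ (x - y)‖ + ‖ψ (S.incl (f 1))‖ + ‖ψ z‖ := by
        nth_rewrite 1 [h5]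
        rw [map_add, map_add]
        exact norm_add₃_le
    _ ≤ ‖x - y‖ + ‖S.incl (f 1)‖ + ‖ψ z‖ := by
        gcongr <;> exact hψ.norm_apply_le _
    _ < ε / 3 + ε / 3 + ε / 3 := by gcongr
    _ = ε := by ring

end TwistedAction

/-! ### Tracial states -/

section Order

attribute [local instance] CStarAlgebra.spectralOrder CStarAlgebra.spectralOrderedRing

theorem IsTracialState.exists_bound {A : Type*} [CStarAlgebra A] {φ : A →ₗ[ℂ] ℂ}
    (hφ : IsTracialState φ) : ∃ C : ℝ, 0 ≤ C ∧ ∀ a, ‖φ a‖ ≤ C * ‖a‖ := by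
  obtain ⟨C, hC⟩ := (PositiveLinearMap.mk₀ φ fun a ha => by
    obtain ⟨b, rfl⟩ := CStarAlgebra.nonneg_iff_eq_star_mul_self.1 ha
    exact hφ.nonneg b).exists_norm_apply_le
  exact ⟨C, C.2, hC⟩

end Order

theorem IsTracialState.continuous {A : Type*} [CStarAlgebra A] {φ : A →ₗ[ℂ] ℂ}
    (hφ : IsTracialState φ) : Continuous φ := by
  obtain ⟨C, -, hC⟩ := hφ.exists_bound
  exact AddMonoidHomClass.continuous_of_bound φ C hC

namespace TwistedAction

variable {A G : Type*} [CStarAlgebra A] [Group G] {S : TwistedAction A G}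

/-- An invariant tracial state composed with the conditional expectation is a tracial state. -/
theorem isTracialState_comp_condExp {φ : A →ₗ[ℂ] ℂ} (hφ : IsTracialState φ)
    (hinv : S.IsInvariantFunctional φ) : IsTracialState (φ ∘ₗ S.condExp) where
  nonneg x := by
    obtain ⟨b, hb⟩ := S.exists_condExp_star_mul_self x
    change 0 ≤ φ (S.condExp (star x * x))
    rw [hb]
    exact hφ.nonneg b
  map_one := by
    change φ (S.condExp 1) = 1
    rw [condExp_one, hφ.map_one]
  tracial x y := by
    change φ (S.condExp (x * y)) = φ (S.condExp (y * x))
    have hcont : Continuous fun x => φ (S.condExp x) := hφ.continuous.comp S.continuous_condExp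
    have hincl : ∀ a y, φ (S.condExp (S.incl a * y)) = φ (S.condExp (y * S.incl a)) := fun a y => by
      rw [condExp_incl_mul, condExp_mul_incl, hφ.tracial]
    have hshift : ∀ g y, φ (S.condExp (S.shift g * y)) = φ (S.condExp (y * S.shift g)) :=
      fun g y => by
        rw [← hinv g (S.condExp (y * S.shift g)), ← condExp_conj]
        simp only [mul_assoc, shift_mul_star, mul_one]
    induction x using S.crossedProduct_induction with
    | hclosed =>
      exact isClosed_eq (hcont.comp (continuous_mul_const _)) (hcont.comp (continuous_const_mul _))
    | hadd x x' hx hx' => rw [add_mul, mul_add, map_add, map_add, map_add, map_add, hx, hx']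
    | hsmul c x hx => rw [smul_mul_assoc, mul_smul_comm, map_smul, map_smul, map_smul, map_smul, hx]
    | h a g => rw [mul_assoc, hincl, mul_assoc, hshift, mul_assoc]

/-- The restriction of a tracial state of the crossed product to `A` is an invariant tracial
state. -/
theorem isTracialState_comp_incl {τ : S.CrossedProduct →ₗ[ℂ] ℂ} (hτ : IsTracialState τ) :
    IsTracialState (τ ∘ₗ S.incl.toAlgHom.toLinearMap) ∧
      S.IsInvariantFunctional (τ ∘ₗ S.incl.toAlgHom.toLinearMap) := by
  refine ⟨⟨fun a => ?_, ?_, fun a b => ?_⟩, fun g a => ?_⟩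
  · change 0 ≤ τ (S.incl (star a * a))
    rw [map_mul, map_star]
    exact hτ.nonneg _
  · change τ (S.incl 1) = 1
    rw [map_one, hτ.map_one]
  · change τ (S.incl (a * b)) = τ (S.incl (b * a))
    rw [map_mul S.incl, map_mul S.incl, hτ.tracial]
  · change τ (S.incl (S.act g a)) = τ (S.incl a)
    rw [← mul_one (S.incl (S.act g a)), ← S.shift_mul_star g, ← mul_assoc, ← shift_mul_incl,
      hτ.tracial, ← mul_assoc, star_shift_mul, one_mul]

/-- Every tracial state of the crossed product factors through the conditional expectation. -/
theorem apply_incl_condExp (hG : IsClassP G) {τ : S.CrossedProduct →ₗ[ℂ] ℂ}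
    (hτ : IsTracialState τ) (x : S.CrossedProduct) : τ (S.incl (S.condExp x)) = τ x := by
  obtain ⟨C, hC0, hC⟩ := hτ.exists_bound
  have h0 : S.condExp (x - S.incl (S.condExp x)) = 0 := by rw [map_sub, condExp_incl, sub_self]
  have h1 : τ (x - S.incl (S.condExp x)) = 0 := by
    refine norm_le_zero_iff.1 (le_of_forall_pos_le_add fun ε hε => ?_)
    obtain ⟨ψ, hψ, hlt⟩ := S.exists_isIteratedAverage_norm_lt hG h0
      (div_pos hε (by positivity : 0 < C + 1))
    rw [← hψ.map_eq_of_isTracialState hτ, zero_add]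
    calc _ ≤ C * ‖ψ (x - S.incl (S.condExp x))‖ := hC _
      _ ≤ (C + 1) * (ε / (C + 1)) := by
          gcongr
          exact le_add_of_nonneg_right zero_le_one
      _ = ε := by field_simp
  rw [map_sub, sub_eq_zero] at h1
  exact h1.symm

theorem bijOn_tracialStates (hG : IsClassP G) :
    Set.BijOn (fun φ : A →ₗ[ℂ] ℂ => φ ∘ₗ S.condExp)
      {φ | IsTracialState φ ∧ S.IsInvariantFunctional φ} {τ | IsTracialState τ} := by
  refine ⟨fun φ hφ => isTracialState_comp_condExp hφ.1 hφ.2, fun φ _ φ' _ h => ?_, fun τ hτ => ?_⟩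
  · ext a
    simpa only [LinearMap.comp_apply, condExp_incl] using DFunLike.congr_fun h (S.incl a)
  · exact ⟨_, isTracialState_comp_incl hτ, LinearMap.ext fun x => apply_incl_condExp hG hτ x⟩

end TwistedAction

/-! ### Closed ideals and ⋆-homomorphisms -/

namespace ClosedIdeal

variable {A B C : Type*} [CStarAlgebra A] [CStarAlgebra B] [CStarAlgebra C]

theorem le_iff {I J : ClosedIdeal A} : I ≤ J ↔ ∀ a ∈ I, a ∈ J :=
  TwoSidedIdeal.le_iff

theorem zero_mem (J : ClosedIdeal A) : 0 ∈ J := J.ideal.zero_mem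

theorem add_mem (J : ClosedIdeal A) {a b : A} (ha : a ∈ J) (hb : b ∈ J) : a + b ∈ J :=
  J.ideal.add_mem ha hb

theorem neg_mem (J : ClosedIdeal A) {a : A} (ha : a ∈ J) : -a ∈ J := J.ideal.neg_mem ha

theorem mul_mem_left (J : ClosedIdeal A) (a : A) {b : A} (hb : b ∈ J) : a * b ∈ J :=
  J.ideal.mul_mem_left a b hb

theorem mul_mem_right (J : ClosedIdeal A) {a : A} (b : A) (ha : a ∈ J) : a * b ∈ J :=
  J.ideal.mul_mem_right a b ha

theorem mem_of_isUnit_mem {J : ClosedIdeal A} {u : A} (hu : IsUnit u) (h : u ∈ J) (a : A) :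
    a ∈ J := by
  obtain ⟨u, rfl⟩ := hu
  rw [← Units.inv_mul_cancel_right a u]
  exact J.mul_mem_left _ h

theorem isProper_iff_one_notMem {J : ClosedIdeal A} : J.IsProper ↔ (1 : A) ∉ J :=
  ⟨fun ⟨a, ha⟩ h1 => ha (mem_of_isUnit_mem isUnit_one h1 a), fun h => ⟨1, h⟩⟩

/-- A closed set that is closed under addition, negation and multiplication by arbitrary elements
is a closed ideal. -/
def ofSet (s : Set A) (h0 : 0 ∈ s) (hadd : ∀ a ∈ s, ∀ b ∈ s, a + b ∈ s) (hneg : ∀ a ∈ s, -a ∈ s)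
    (hleft : ∀ a, ∀ b ∈ s, a * b ∈ s) (hright : ∀ a ∈ s, ∀ b, a * b ∈ s) (hs : IsClosed s) :
    ClosedIdeal A where
  ideal := TwoSidedIdeal.mk' s h0 (fun ha hb => hadd _ ha _ hb) (fun ha => hneg _ ha)
    (fun hb => hleft _ _ hb) (fun ha => hright _ ha _)
  isClosed := by rwa [TwoSidedIdeal.coe_mk']

theorem mem_ofSet {s : Set A} (h0 : 0 ∈ s) (hadd : ∀ a ∈ s, ∀ b ∈ s, a + b ∈ s)
    (hneg : ∀ a ∈ s, -a ∈ s) (hleft : ∀ a, ∀ b ∈ s, a * b ∈ s) (hright : ∀ a ∈ s, ∀ b, a * b ∈ s)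
    (hs : IsClosed s) {a : A} : a ∈ ofSet s h0 hadd hneg hleft hright hs ↔ a ∈ s :=
  TwoSidedIdeal.mem_mk' s h0 (fun ha hb => hadd _ ha _ hb) (fun ha => hneg _ ha)
    (fun hb => hleft _ _ hb) (fun ha => hright _ ha _) a

/-- The preimage of a closed ideal under a ⋆-homomorphism. -/
def comap (φ : A →⋆ₐ[ℂ] B) (J : ClosedIdeal B) : ClosedIdeal A :=
  ofSet {a | φ a ∈ J}
    (by rw [Set.mem_ofPred_eq, map_zero]; exact J.zero_mem)
    (fun a ha b hb => by rw [Set.mem_ofPred_eq, map_add]; exact J.add_mem ha hb)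
    (fun a ha => by rw [Set.mem_ofPred_eq, map_neg]; exact J.neg_mem ha)
    (fun a b hb => by rw [Set.mem_ofPred_eq, map_mul]; exact J.mul_mem_left _ hb)
    (fun a ha b => by rw [Set.mem_ofPred_eq, map_mul]; exact J.mul_mem_right _ ha)
    (J.isClosed.preimage (starAlgHom_continuous φ))

theorem mem_comap {φ : A →⋆ₐ[ℂ] B} {J : ClosedIdeal B} {a : A} : a ∈ comap φ J ↔ φ a ∈ J :=
  mem_ofSet ..

/-- The zero ideal. -/
def zero : ClosedIdeal A where
  ideal := ⊥
  isClosed := by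
    rw [show ((⊥ : TwoSidedIdeal A) : Set A) = {0} from
      Set.ext fun _ => TwoSidedIdeal.mem_bot A]
    exact isClosed_singleton

theorem mem_zero {a : A} : a ∈ (zero : ClosedIdeal A) ↔ a = 0 := TwoSidedIdeal.mem_bot A

/-- The kernel of a ⋆-homomorphism. -/
def ker (φ : A →⋆ₐ[ℂ] B) : ClosedIdeal A := comap φ zero

theorem mem_ker {φ : A →⋆ₐ[ℂ] B} {a : A} : a ∈ ker φ ↔ φ a = 0 := mem_comap.trans mem_zero

theorem mem_of_map_eq {φ : A →⋆ₐ[ℂ] B} {J : ClosedIdeal A} (hJ : ker φ ≤ J) {a b : A}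
    (hb : b ∈ J) (h : φ b = φ a) : a ∈ J := by
  have h1 : a - b ∈ J := le_iff.1 hJ _ (mem_ker.2 (by rw [map_sub, h, sub_self]))
  rw [← sub_add_cancel a b]
  exact J.add_mem h1 hb

/-- The image of a closed ideal under a surjective ⋆-homomorphism whose kernel it contains. -/
def map (φ : A →⋆ₐ[ℂ] B) (hφ : Function.Surjective φ) (J : ClosedIdeal A) (hJ : ker φ ≤ J) :
    ClosedIdeal B :=
  ofSet {b | ∃ a ∈ J, φ a = b} ⟨0, J.zero_mem, map_zero φ⟩
    (by
      rintro _ ⟨a, ha, rfl⟩ _ ⟨b, hb, rfl⟩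
      exact ⟨a + b, J.add_mem ha hb, map_add φ a b⟩)
    (by
      rintro _ ⟨a, ha, rfl⟩
      exact ⟨-a, J.neg_mem ha, map_neg φ a⟩)
    (by
      rintro c _ ⟨b, hb, rfl⟩
      obtain ⟨a, rfl⟩ := hφ c
      exact ⟨a * b, J.mul_mem_left _ hb, map_mul φ a b⟩)
    (by
      rintro _ ⟨a, ha, rfl⟩ c
      obtain ⟨b, rfl⟩ := hφ c
      exact ⟨a * b, J.mul_mem_right _ ha, map_mul φ a b⟩)
    (by
      let f : A →L[ℂ] B := ⟨φ.toAlgHom.toLinearMap, starAlgHom_continuous φ⟩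
      have hf : Topology.IsQuotientMap φ := f.isQuotientMap hφ
      rw [← hf.isClosed_preimage]
      convert J.isClosed using 1
      ext a
      exact ⟨fun ⟨b, hb, hba⟩ => mem_of_map_eq hJ hb hba, fun ha => ⟨a, ha, rfl⟩⟩)

theorem mem_map {φ : A →⋆ₐ[ℂ] B} {hφ : Function.Surjective φ} {J : ClosedIdeal A}
    {hJ : ker φ ≤ J} {a : A} : φ a ∈ map φ hφ J hJ ↔ a ∈ J :=
  (mem_ofSet ..).trans ⟨fun ⟨_, hb, hba⟩ => mem_of_map_eq hJ hb hba, fun ha => ⟨a, ha, rfl⟩⟩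

/-- The image of a surjective ⋆-homomorphism is simple if and only if its kernel is maximal. -/
theorem isSimple_iff_isMaximal_ker {φ : A →⋆ₐ[ℂ] B} (hφ : Function.Surjective φ) :
    IsSimpleCStarAlgebra B ↔ (ker φ).IsMaximal := by
  constructor
  · rintro ⟨hB, h⟩
    refine ⟨isProper_iff_one_notMem.2 fun h1 => ?_, fun K hK hle => ?_⟩
    · rw [mem_ker, map_one] at h1
      exact one_ne_zero h1
    · rcases h (map φ hφ K hle) with h | h
      · exact le_iff.2 fun a ha => mem_ker.2 (h _ (mem_map.2 ha))
      · obtain ⟨a, ha⟩ := hK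
        exact absurd (mem_map.1 (h (φ a))) ha
  · rintro ⟨h1, h⟩
    rw [isProper_iff_one_notMem, mem_ker, map_one] at h1
    refine ⟨⟨1, 0, h1⟩, fun K => ?_⟩
    by_cases hK : (comap φ K).IsProper
    · left
      intro b hb
      obtain ⟨a, rfl⟩ := hφ b
      refine mem_ker.1 (le_iff.1 (h hK (le_iff.2 fun c hc => ?_)) a (mem_comap.2 hb))
      rw [mem_comap, mem_ker.1 hc]
      exact K.zero_mem
    · right
      intro b
      obtain ⟨a, rfl⟩ := hφ b
      by_contra hb
      exact hK ⟨a, fun ha => hb (mem_comap.1 ha)⟩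

theorem lift_ker_injective (φ : A →⋆ₐ[ℂ] B) :
    Function.Injective ((ker φ).lift φ fun _ h => mem_ker.1 h) := by
  rw [injective_iff_map_eq_zero]
  intro x hx
  obtain ⟨a, rfl⟩ := (ker φ).proj_surjective x
  exact (ker φ).proj_eq_zero_iff.2 (mem_ker.2 hx)

theorem isClosed_range_starAlgHom (φ : A →⋆ₐ[ℂ] B) : IsClosed (Set.range φ) := by
  have h : Set.range φ = Set.range ((ker φ).lift φ fun _ h => mem_ker.1 h) := by
    ext b
    constructor
    · rintro ⟨a, rfl⟩
      exact ⟨(ker φ).proj a, rfl⟩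
    · rintro ⟨x, rfl⟩
      obtain ⟨a, rfl⟩ := (ker φ).proj_surjective x
      exact ⟨a, rfl⟩
  rw [h]
  exact (NonUnitalStarAlgHom.isometry _ (lift_ker_injective φ)).isClosedEmbedding.isClosed_range

/-- Two surjective ⋆-homomorphisms with the same kernel have isomorphic images. -/
theorem exists_starAlgEquiv_of_ker_eq {φ : A →⋆ₐ[ℂ] B} {χ : A →⋆ₐ[ℂ] C}
    (hφ : Function.Surjective φ) (hχ : Function.Surjective χ) (h : ∀ a, φ a = 0 ↔ χ a = 0) :
    ∃ e : B ≃⋆ₐ[ℂ] C, ∀ a, e (φ a) = χ a := by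
  have hχ' : ∀ a ∈ ker φ, χ a = 0 := fun a ha => (h a).1 (mem_ker.1 ha)
  have h1 : Function.Bijective ((ker φ).lift φ fun _ h => mem_ker.1 h) :=
    ⟨lift_ker_injective φ, fun b => (hφ b).imp' (ker φ).proj fun _ ha => ha⟩
  have h2 : Function.Bijective ((ker φ).lift χ hχ') := by
    refine ⟨?_, fun b => (hχ b).imp' (ker φ).proj fun _ ha => ha⟩
    rw [injective_iff_map_eq_zero]
    intro x hx
    obtain ⟨a, rfl⟩ := (ker φ).proj_surjective x
    exact (ker φ).proj_eq_zero_iff.2 (mem_ker.2 ((h a).2 hx))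
  refine ⟨(StarAlgEquiv.ofBijective _ h1).symm.trans (StarAlgEquiv.ofBijective _ h2), fun a => ?_⟩
  have h3 : (StarAlgEquiv.ofBijective _ h1).symm (φ a) = (ker φ).proj a := by
    rw [StarAlgEquiv.symm_apply_eq]
    rfl
  rw [StarAlgEquiv.trans_apply, h3]
  rfl

end ClosedIdeal

namespace TwistedAction

variable {A G : Type*} [CStarAlgebra A] [Group G] {S : TwistedAction A G}

/-! ### Ideals of the crossed product -/

open ClosedIdeal

variable (S) in
/-- The closure of the image of an ideal of the crossed product under the conditional expectation;
it is an ideal of `A`. -/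
def condExpIdeal (K : ClosedIdeal S.CrossedProduct) : ClosedIdeal A :=
  ofSet (closure (S.condExp '' K)) (subset_closure ⟨0, K.zero_mem, map_zero _⟩)
    (fun a ha b hb => map_mem_closure₂ continuous_add ha hb (by
      rintro _ ⟨x, hx, rfl⟩ _ ⟨y, hy, rfl⟩
      exact ⟨x + y, K.add_mem hx hy, map_add _ x y⟩))
    (fun a ha => map_mem_closure continuous_neg ha (by
      rintro _ ⟨x, hx, rfl⟩
      exact ⟨-x, K.neg_mem hx, map_neg _ x⟩))
    (fun a b hb => map_mem_closure (continuous_const_mul a) hb (by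
      rintro _ ⟨y, hy, rfl⟩
      exact ⟨S.incl a * y, K.mul_mem_left _ hy, S.condExp_incl_mul a y⟩))
    (fun a ha b => map_mem_closure (f := (· * b)) (continuous_mul_const b) ha (by
      rintro _ ⟨x, hx, rfl⟩
      exact ⟨x * S.incl b, K.mul_mem_right _ hx, S.condExp_mul_incl b x⟩))
    isClosed_closure

theorem mem_condExpIdeal {K : ClosedIdeal S.CrossedProduct} {a : A} :
    a ∈ S.condExpIdeal K ↔ a ∈ closure (S.condExp '' K) := mem_ofSet ..

theorem condExp_mem_condExpIdeal {K : ClosedIdeal S.CrossedProduct} {x : S.CrossedProduct}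
    (hx : x ∈ K) : S.condExp x ∈ S.condExpIdeal K :=
  mem_condExpIdeal.2 (subset_closure ⟨x, hx, rfl⟩)

/-- Invariance under each `α_g` follows from stability under each `α_g`, since the inverse of `α_g`
is `α_{g⁻¹}` up to an inner automorphism. -/
theorem isInvariant_of_forall_act_mem {J : ClosedIdeal A} (h : ∀ g, ∀ a ∈ J, S.act g a ∈ J) :
    S.IsInvariant J := fun g a => by
  refine ⟨fun ha => ?_, h g a⟩
  have h1 := h g⁻¹ _ ha
  rw [S.act_act, inv_mul_cancel, act_one] at h1
  set u := S.cocycle g⁻¹ g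
  have h2 : star (u : A) * (u * a * star (u : A)) * u ∈ J :=
    J.mul_mem_right _ (J.mul_mem_left _ h1)
  have h3 : star (u : A) * u = 1 := Unitary.star_mul_self_of_mem u.2
  have h4 : star (u : A) * (u * a * star (u : A)) * u = star (u : A) * u * a * (star (u : A) * u) :=
    by simp only [mul_assoc]
  rwa [h4, h3, one_mul, mul_one] at h2

theorem isInvariant_condExpIdeal (K : ClosedIdeal S.CrossedProduct) :
    S.IsInvariant (S.condExpIdeal K) :=
  isInvariant_of_forall_act_mem fun g a ha => mem_condExpIdeal.2 <|
    map_mem_closure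
      (NonUnitalStarAlgHom.isometry (S.act g) (EquivLike.injective _)).continuous
      (mem_condExpIdeal.1 ha) (by
        rintro _ ⟨x, hx, rfl⟩
        exact ⟨_, K.mul_mem_right _ (K.mul_mem_left _ hx), S.condExp_conj g x⟩)

/-- If the image of `K` under the conditional expectation is dense, then `K` contains an element
`y` with `E(y) = 1`, whose averages, again in `K`, come close to `1`. -/
theorem isProper_condExpIdeal (hG : IsClassP G) {K : ClosedIdeal S.CrossedProduct}
    (hK : K.IsProper) : (S.condExpIdeal K).IsProper := by
  rw [isProper_iff_one_notMem, mem_condExpIdeal]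
  intro h1
  obtain ⟨_, ⟨x, hx, rfl⟩, hlt⟩ := Metric.mem_closure_iff.1 h1 1 zero_lt_one
  rw [dist_eq_norm] at hlt
  set u := Units.oneSub _ hlt
  have hu : (u : A) = S.condExp x := by simp [u]
  set y := S.incl (↑u⁻¹ : A) * x
  have hy : y ∈ K := K.mul_mem_left _ hx
  have hEy : S.condExp (1 - y) = 0 := by
    rw [map_sub, condExp_one, condExp_incl_mul, ← hu, Units.inv_mul, sub_self]
  obtain ⟨ψ, hψ, hψy⟩ := S.exists_isIteratedAverage_norm_lt hG hEy zero_lt_one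
  rw [map_sub, hψ.map_one] at hψy
  have hunit : IsUnit (ψ y) := ⟨Units.oneSub _ hψy, by simp⟩
  obtain ⟨z, hz⟩ := hK
  exact hz (mem_of_isUnit_mem hunit (hψ.apply_mem K hy) z)

/-- An ideal `K` with `E(K) ⊆ J` is contained in the kernel of the quotient map given by `J`: for
`x` in `K` the faithful conditional expectation of the quotient system vanishes at the image of
`star x * x`. -/
theorem le_ker_quotientHom {K : ClosedIdeal S.CrossedProduct} {J : ClosedIdeal A}
    (hJ : S.IsInvariant J) (h : ∀ x ∈ K, S.condExp x ∈ J) : K ≤ ker (S.quotientHom J hJ) :=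
  le_iff.2 fun x hx => by
    refine mem_ker.2 (eq_zero_of_condExp_star_mul_self _ fun g => ?_)
    rw [← quotientHom_shift, ← map_mul, ← map_star, ← map_mul, condExp_quotientHom,
      proj_eq_zero_iff]
    exact h _ (K.mul_mem_left _ (K.mul_mem_right _ hx))

theorem le_ker_quotientHom_condExpIdeal (K : ClosedIdeal S.CrossedProduct) :
    K ≤ ker (S.quotientHom _ (isInvariant_condExpIdeal K)) :=
  le_ker_quotientHom _ fun _ hx => condExp_mem_condExpIdeal hx

variable {J : ClosedIdeal A}

theorem quotientHom_incl_eq_zero_iff (hJ : S.IsInvariant J) {a : A} :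
    S.quotientHom J hJ (S.incl a) = 0 ↔ a ∈ J := by
  rw [quotientHom_incl]
  refine ⟨fun h => ?_, fun h => ?_⟩
  · rw [← J.proj_eq_zero_iff, ← (S.quotient J hJ).condExp_incl (J.proj a), h, map_zero]
  · rw [J.proj_eq_zero_iff.2 h, map_zero]

theorem isProper_ker_quotientHom_iff (hJ : S.IsInvariant J) :
    (ker (S.quotientHom J hJ)).IsProper ↔ J.IsProper := by
  rw [isProper_iff_one_notMem, isProper_iff_one_notMem, mem_ker, ← map_one S.incl,
    quotientHom_incl_eq_zero_iff]

theorem ker_quotientHom_le_iff {J' : ClosedIdeal A} (hJ : S.IsInvariant J)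
    (hJ' : S.IsInvariant J') :
    ker (S.quotientHom J hJ) ≤ ker (S.quotientHom J' hJ') ↔ J ≤ J' := by
  refine ⟨fun h => le_iff.2 fun a ha => ?_, fun h => le_ker_quotientHom hJ' fun x hx => ?_⟩
  · rw [← quotientHom_incl_eq_zero_iff hJ']
    exact mem_ker.1 (le_iff.1 h _ (mem_ker.2 ((quotientHom_incl_eq_zero_iff hJ).2 ha)))
  · refine le_iff.1 h _ (J.proj_eq_zero_iff.1 ?_)
    rw [← condExp_quotientHom (hJ := hJ), mem_ker.1 hx, map_zero]

/-- Every maximal ideal of the crossed product is the kernel of the quotient map of a maximal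
invariant ideal of `A`. -/
theorem exists_eq_ker_quotientHom (hG : IsClassP G) {K : ClosedIdeal S.CrossedProduct}
    (hK : K.IsMaximal) :
    ∃ (J : ClosedIdeal A) (hJ : S.IsInvariant J), S.IsMaximalInvariant J ∧
      ker (S.quotientHom J hJ) = K := by
  have hJ := isInvariant_condExpIdeal K
  have hle := le_ker_quotientHom_condExpIdeal K
  have hproper := isProper_condExpIdeal hG hK.1
  have heq : ker (S.quotientHom _ hJ) = K :=
    (hK.eq_of_le ((isProper_ker_quotientHom_iff hJ).2 hproper) hle).symm
  refine ⟨_, hJ, ⟨⟨hproper, hJ⟩, fun J' hJ' hle' => ?_⟩, heq⟩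
  rw [← ker_quotientHom_le_iff hJ hJ'.2] at hle'
  rw [← ker_quotientHom_le_iff hJ'.2 hJ, heq]
  rw [heq] at hle'
  exact hK.2 ((isProper_ker_quotientHom_iff hJ'.2).2 hJ'.1) hle'

theorem isMaximal_ker_quotientHom (hG : IsClassP G) (hJ : S.IsInvariant J)
    (hmax : S.IsMaximalInvariant J) : (ker (S.quotientHom J hJ)).IsMaximal := by
  refine ⟨(isProper_ker_quotientHom_iff hJ).2 hmax.1.1, fun K hK hle => ?_⟩
  have hJ' := isInvariant_condExpIdeal K
  have hle' := le_ker_quotientHom_condExpIdeal K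
  have h1 : J ≤ S.condExpIdeal K := (ker_quotientHom_le_iff hJ hJ').1 (hle.trans hle')
  have h2 := hmax.2 ⟨isProper_condExpIdeal hG hK, hJ'⟩ h1
  exact hle'.trans ((ker_quotientHom_le_iff hJ' hJ).2 h2)

theorem quotientHom_surjective (hJ : S.IsInvariant J) :
    Function.Surjective (S.quotientHom J hJ) := fun y => by
  induction y using (S.quotient J hJ).crossedProduct_induction with
  | hclosed => exact isClosed_range_starAlgHom (S.quotientHom J hJ)
  | hadd x y hx hy =>
    obtain ⟨x, rfl⟩ := hx
    obtain ⟨y, rfl⟩ := hy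
    exact ⟨x + y, map_add _ x y⟩
  | hsmul c x hx =>
    obtain ⟨x, rfl⟩ := hx
    exact ⟨c • x, map_smul _ c x⟩
  | h a g =>
    obtain ⟨a, rfl⟩ := J.proj_surjective a
    exact ⟨S.incl a * S.shift g, by rw [map_mul, quotientHom_incl, quotientHom_shift]⟩

theorem inducedIdeal_eq_ker (hS : S.IsExact) (hJ : S.IsInvariant J) :
    S.inducedIdeal J = ker (S.quotientHom J hJ) :=
  SetLike.ext fun x => (hS J hJ x).trans mem_ker.symm

theorem bijOn_inducedIdeal (hG : IsClassP G) (hS : S.IsExact) :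
    Set.BijOn S.inducedIdeal {J | S.IsMaximalInvariant J} {K | K.IsMaximal} := by
  refine ⟨fun J hJ => ?_, fun J hJ J' hJ' h => ?_, fun K hK => ?_⟩
  · rw [inducedIdeal_eq_ker hS hJ.1.2]
    exact isMaximal_ker_quotientHom hG hJ.1.2 hJ
  · rw [inducedIdeal_eq_ker hS hJ.1.2, inducedIdeal_eq_ker hS hJ'.1.2] at h
    exact le_antisymm ((ker_quotientHom_le_iff hJ.1.2 hJ'.1.2).1 h.le)
      ((ker_quotientHom_le_iff hJ'.1.2 hJ.1.2).1 h.ge)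
  · obtain ⟨J, hJ, hmax, rfl⟩ := exists_eq_ker_quotientHom hG hK
    exact ⟨J, hmax, inducedIdeal_eq_ker hS hJ⟩

end TwistedAction

end

theorem corollary3p9 {A G : Type*} [CStarAlgebra A] [Group G]
    (S : TwistedAction A G) (hG : IsClassP G) :
    Set.BijOn (fun φ : A →ₗ[ℂ] ℂ => φ ∘ₗ S.condExp)
        {φ | IsTracialState φ ∧ S.IsInvariantFunctional φ} {τ | IsTracialState τ} ∧
      (S.IsExact →
        Set.BijOn S.inducedIdeal {J | S.IsMaximalInvariant J} {K | K.IsMaximal} ∧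
        (∀ (J : ClosedIdeal A) (hJ : S.IsInvariant J), S.IsMaximalInvariant J →
          Function.Surjective (S.quotientHom J hJ) ∧
          IsSimpleCStarAlgebra (S.quotient J hJ).CrossedProduct) ∧
        (∀ (D : Type*) [CStarAlgebra D] (q : S.CrossedProduct →⋆ₐ[ℂ] D),
          Function.Surjective q → IsSimpleCStarAlgebra D →
          ∃ (J : ClosedIdeal A) (hJ : S.IsInvariant J)
            (e : (S.quotient J hJ).CrossedProduct ≃⋆ₐ[ℂ] D),
            S.IsMaximalInvariant J ∧ ∀ x, e (S.quotientHom J hJ x) = q x)) := by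
  refine ⟨TwistedAction.bijOn_tracialStates hG, fun hS =>
    ⟨TwistedAction.bijOn_inducedIdeal hG hS, fun J hJ hmax => ?_, fun D _ q hq hD => ?_⟩⟩
  · have hsurj := TwistedAction.quotientHom_surjective hJ
    exact ⟨hsurj, (ClosedIdeal.isSimple_iff_isMaximal_ker hsurj).2
      (TwistedAction.isMaximal_ker_quotientHom hG hJ hmax)⟩
  · obtain ⟨J, hJ, hmax, hker⟩ := TwistedAction.exists_eq_ker_quotientHom hG
      ((ClosedIdeal.isSimple_iff_isMaximal_ker hq).1 hD)
    obtain ⟨e, he⟩ := ClosedIdeal.exists_starAlgEquiv_of_ker_eq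
      (TwistedAction.quotientHom_surjective hJ) hq fun x => by
        rw [← ClosedIdeal.mem_ker, hker, ClosedIdeal.mem_ker]
    exact ⟨J, hJ, e, hmax, he⟩
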